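/- **Setting.** A continuum robot with $n$ actuation degrees of freedom is given by a length $l>0$, positive constants $E,I,G,J,A$ with stiffness matrix $C=\mathrm{diag}(EI,EI,GJ,GA,GA,EA)$, a natural twist $\xi_0\in\mathbb{R}^6$, smooth potentials $\mathcal U,\mathcal U^+:SE(3)\to\mathbb{R}$, and a smooth actuation wrench $\Lambda_{ad}:\mathbb{R}^n\to\mathbb{R}^6$. Assume that $\tau$ is determined continuously by $\Lambda_{ad}(\tau)$, i.e. $\Lambda_{ad}$ is a homeomorphism onto its image. The wrenches $W,W_+:SE(3)\to\mathbb{R}^6$ are defined by $\zeta^TW(g)=-\frac{d}{dt}\big|_{t=0}\,\mathcal U(g\exp(t\hat\zeta))$, and likewise $W_+$ from $\mathcal U^+$, for $\zeta\in\mathbb{R}^6$. Here, for $\xi=[\omega;v]\in\mathbb{R}^3\oplus\mathbb{R}^3$, $\hat\xi=\begin{bmatrix}\hat\omega&v\\0&0\end{bmatrix}$, $\mathrm{ad}_\xi=\begin{bmatrix}\hat\omega&0\\\hat v&\hat\omega\end{bmatrix}$, and $\hat\omega$ is the matrix of $\omega\times\cdot$. Let $C^\infty([0,l],SE(3)\times\mathbb{R}^6)$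 carry the smooth topology (uniform convergence of all derivatives). For $\tau\in\mathbb{R}^n$ consider, for $(g,u)$ in this space, $$g'=g(\xi_0+u)^{\wedge},\quad \Lambda'=\mathrm{ad}_{\xi_0+u}^T\Lambda-W(g),\quad \Lambda=Cu+\Lambda_{ad}(\tau),\quad g(0)=e. \tag{1}$$ Let $\mathcal C$ be the set of all $(g,u)$ that satisfy (1) and $\Lambda(l)=W_+(g(l))$ for some $\tau$. For $(\lambda,\tau)\in\mathbb{R}^6\times\mathbb{R}^n$ let $\Psi(\lambda,\tau)=(g,u)$ be the solution of (1) with $Cu(0)=\lambda$, defined on the set $D$ of those $(\lambda,\tau)$ for which it exists on all of $[0,l]$; let $F(\lambda,\tau)=\Lambda(l)-W_+(g(l))\in\mathbb{R}^6$ on $D$, and $$\bar{\mathcal A}=\{(\lambda,\tau)\in D: F(\lambda,\tau)=0,\ \mathrm{rank}\,F_\lambda(\lambda,\tau)=6\}.$$ **Theorem.** $\Psi(\bar{\mathcal A})\subset\mathcal C$, and $\Psi(\bar{\mathcal A})$, with the subspace topology, is a smooth manifold of dimension $n$ (Hausdorff and second countable). More precisely, it has a smooth structure for which $(g,u)(s)$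 is jointly smooth in $(g,u)\in\Psi(\bar{\mathcal A})$ and $s\in[0,l]$, and for which $\Psi:\bar{\mathcal A}\to\Psi(\bar{\mathcal A})$ is a bijection whose inverse, as a map into $\mathbb{R}^6\times\mathbb{R}^n$, is a smooth embedding (so $\bar{\mathcal A}$ is an $n$-dimensional embedded submanifold and $\Psi$ a diffeomorphism from it onto $\Psi(\bar{\mathcal A})$). -/

import Mathlib

open Set Topology
open scoped Matrix Manifold ContDiff

noncomputable section

namespace ContinuumRobot

/-- Column vectors `[ω; v]` (or wrenches `[m; f]`) in `ℝ⁶ = ℝ³ ⊕ ℝ³`. -/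
abbrev Vec6 : Type := Fin 3 ⊕ Fin 3 → ℝ

/-- `4 × 4` real matrices in block form `3 + 1`. -/
abbrev Mat4 : Type := Matrix (Fin 3 ⊕ Fin 1) (Fin 3 ⊕ Fin 1) ℝ

/-- The same space as an array of entries, which carries the norm used for derivatives. -/
abbrev Arr : Type := Fin 3 ⊕ Fin 1 → Fin 3 ⊕ Fin 1 → ℝ

/-- The array of entries of a matrix. -/
def entries (M : Mat4) : Arr := fun i j => M i j

/-- The actuation space `ℝⁿ`. -/
abbrev Act (n : ℕ) : Type := EuclideanSpace ℝ (Fin n)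

/-- The special Euclidean group `SE(3)`, as homogeneous matrices `[R p; 0 1]`, `R ∈ SO(3)`. -/
def SE3 : Set Mat4 :=
  {M | ∃ R ∈ Matrix.specialOrthogonalGroup (Fin 3) ℝ, ∃ p : Matrix (Fin 3) (Fin 1) ℝ,
    M = Matrix.fromBlocks R p 0 1}

/-- The hat map `ℝ³ → 𝔰𝔬(3)`. -/
def hat3 (w : Fin 3 → ℝ) : Matrix (Fin 3) (Fin 3) ℝ :=
  !![0, -w 2, w 1;
     w 2, 0, -w 0;
     -w 1, w 0, 0]

/-- The hat map `ℝ⁶ → 𝔰𝔢(3)`, `[ω; v] ↦ [ω̂ v; 0 0]`. -/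
def hat (ξ : Vec6) : Mat4 :=
  Matrix.fromBlocks (hat3 fun i => ξ (.inl i)) (Matrix.of fun i _ => ξ (.inr i)) 0 0

/-- `ad_ξ = [ω̂ 0; v̂ ω̂]` for `ξ = [ω; v]`. -/
def ad (ξ : Vec6) : Matrix (Fin 3 ⊕ Fin 3) (Fin 3 ⊕ Fin 3) ℝ :=
  Matrix.fromBlocks (hat3 fun i => ξ (.inl i)) 0
    (hat3 fun i => ξ (.inr i)) (hat3 fun i => ξ (.inl i))

/-- Smoothness of a real function on the submanifold `SE(3)` of the space of `4 × 4` matrices: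
near every point it is the restriction of a smooth function defined on an open set of matrices. -/
def SmoothOnSE3 (f : SE3 → ℝ) : Prop :=
  ∀ g : SE3, ∃ V : Set Arr, IsOpen V ∧ entries g ∈ V ∧
    ∃ F : Arr → ℝ, ContDiffOn ℝ ∞ F V ∧ ∀ h : SE3, entries h ∈ V → f h = F (entries h)

open Classical in
/-- Extension of a function on `SE(3)` by zero to all matrices. -/
def extendSE3 (f : SE3 → ℝ) (M : Mat4) : ℝ :=
  if h : M ∈ SE3 then f ⟨M, h⟩ else 0

/-- The wrench generated by a potential `f : SE(3) → ℝ`: `ζᵀ W(g) = - d/dt f (g exp (t ζ̂))` at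
`t = 0`, given by its components along the standard basis. The curve `t ↦ g exp (t ζ̂)` stays in
`SE(3)`, so that the extension by zero plays no role. -/
def wrenchOf (f : SE3 → ℝ) (g : SE3) : Vec6 := fun i =>
  - deriv (fun t : ℝ => extendSE3 f ((g : Mat4) * NormedSpace.exp (t • hat (Pi.single i 1)))) 0

open Classical in
/-- A function on `[0, l]`, extended by zero to the real line. -/
def onLine {l : ℝ} {V : Type*} [Zero V] (f : Icc (0 : ℝ) l → V) (s : ℝ) : V :=
  if h : s ∈ Icc (0 : ℝ) l then f ⟨s, h⟩ else 0

/-- `C^∞([0, l], SE(3) × ℝ⁶)`: smooth maps `(g, u) : [0, l] → SE(3) × ℝ⁶`. -/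
@[ext]
structure Config (l : ℝ) where
  g : Icc (0 : ℝ) l → SE3
  u : Icc (0 : ℝ) l → Vec6
  smooth_g : ContDiffOn ℝ ∞ (onLine fun s => entries (g s)) (Icc 0 l)
  smooth_u : ContDiffOn ℝ ∞ (onLine u) (Icc 0 l)

namespace Config

variable {l : ℝ}

/-- The curve `s ↦ (g(s), u(s))` in `ℝ^{4×4} × ℝ⁶` (only its values on `[0, l]` matter). -/
def curve (c : Config l) (s : ℝ) : Arr × Vec6 :=
  (onLine (fun s => entries (c.g s)) s, onLine c.u s)

/-- The smooth topology: uniform convergence on `[0, l]` of the curve and of all its derivatives. -/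
instance : TopologicalSpace (Config l) :=
  TopologicalSpace.induced
    (fun c k => UniformFun.ofFun fun s : Icc (0 : ℝ) l =>
      iteratedDerivWithin k c.curve (Icc 0 l) s :
        Config l → ℕ → UniformFun (Icc (0 : ℝ) l) (Arr × Vec6))
    Pi.topologicalSpace

lemma one_mem_SE3 : (1 : Mat4) ∈ SE3 :=
  ⟨1, one_mem _, 0, Matrix.fromBlocks_one.symm⟩

instance : Nonempty (Config l) := by
  have key : ∀ {V : Type} [NormedAddCommGroup V] [NormedSpace ℝ V] (a : V),
      ContDiffOn ℝ ∞ (onLine fun _ : Icc (0 : ℝ) l => a) (Icc 0 l) := fun a =>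
    (contDiffOn_const (c := a)).congr fun s hs => by simp [onLine, hs.1, hs.2]
  exact ⟨⟨fun _ => ⟨1, one_mem_SE3⟩, fun _ => 0, key _, key _⟩⟩

end Config

/-- The data of a continuum robot with `n` actuation degrees of freedom. -/
structure Robot (n : ℕ) where
  /-- length -/
  l : ℝ
  l_pos : 0 < l
  /-- Young's modulus, second moment of area, shear modulus, polar moment, area -/
  (E I G J A : ℝ)
  E_pos : 0 < E
  I_pos : 0 < I
  G_pos : 0 < G
  J_pos : 0 < J
  A_pos : 0 < A
  /-- natural body twist of the backbone -/
  ξ₀ : Vec6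
  /-- distributed external potential -/
  U : SE3 → ℝ
  U_smooth : SmoothOnSE3 U
  /-- potential of the tip wrench -/
  Utip : SE3 → ℝ
  Utip_smooth : SmoothOnSE3 Utip
  /-- actuation wrench -/
  Λad : Act n → Vec6
  Λad_smooth : ContDiff ℝ ∞ Λad

namespace Robot

variable {n : ℕ} (r : Robot n)

/-- The endpoint `0` of `[0, l]`. -/
def base : Icc (0 : ℝ) r.l := ⟨0, left_mem_Icc.2 r.l_pos.le⟩

/-- The endpoint `l` of `[0, l]`. -/
def tip : Icc (0 : ℝ) r.l := ⟨r.l, right_mem_Icc.2 r.l_pos.le⟩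

/-- The stiffness matrix `C = diag(EI, EI, GJ, GA, GA, EA)`. -/
def C : Matrix (Fin 3 ⊕ Fin 3) (Fin 3 ⊕ Fin 3) ℝ :=
  Matrix.diagonal
    (Sum.elim ![r.E * r.I, r.E * r.I, r.G * r.J] ![r.G * r.A, r.G * r.A, r.E * r.A])

/-- The wrench `Λ = C u + Λ_ad(τ)` along a configuration (constitutive law). -/
def Λ (τ : Act n) (c : Config r.l) (s : Icc (0 : ℝ) r.l) : Vec6 :=
  r.C *ᵥ c.u s + r.Λad τ

/-- `(g, u)` satisfies, with actuation `τ`, the canonical equations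
`g' = g (ξ₀ + u)^`, `Λ' = ad_ξᵀ Λ - W(g)` with `ξ = ξ₀ + u`, `Λ = C u + Λ_ad(τ)`, on `[0, l]`,
and starts at `g(0) = e`. -/
structure SolvesODE (τ : Act n) (c : Config r.l) : Prop where
  start : (c.g r.base : Mat4) = 1
  deriv_g : ∀ s : Icc (0 : ℝ) r.l,
    HasDerivWithinAt (onLine fun s => entries (c.g s))
      (entries ((c.g s : Mat4) * hat (r.ξ₀ + c.u s))) (Icc 0 r.l) s
  deriv_Λ : ∀ s : Icc (0 : ℝ) r.l,
    HasDerivWithinAt (onLine (r.Λ τ c))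
      ((ad (r.ξ₀ + c.u s))ᵀ *ᵥ r.Λ τ c s - wrenchOf r.U (c.g s)) (Icc 0 r.l) s

/-- The set `𝒞` of configurations that solve the boundary value problem for some actuation:
the canonical equations together with `Λ(l) = W₊(g(l))`. -/
def configSet : Set (Config r.l) :=
  {c | ∃ τ, r.SolvesODE τ c ∧ r.Λ τ c r.tip - wrenchOf r.Utip (c.g r.tip) = 0}

/-- `(g, u)` is the solution of the initial value problem with data `(λ, τ)`, `λ = C u(0)`. -/
def Shoots (x : Vec6 × Act n) (c : Config r.l) : Prop :=
  r.SolvesODE x.2 c ∧ r.C *ᵥ c.u r.base = x.1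

/-- The pairs `(λ, τ)` for which the initial value problem has a solution on all of `[0, l]`. -/
def shootingDomain : Set (Vec6 × Act n) := {x | ∃ c, r.Shoots x c}

/-- The shooting map `Ψ(λ, τ) = (g, u)`, meaningful on `shootingDomain`, where the initial value
problem has a solution (it is unique). -/
def Ψ (x : Vec6 × Act n) : Config r.l := Classical.epsilon (r.Shoots x)

/-- `F(λ, τ) = Λ(l) - W₊(g(l))` for `(g, u) = Ψ(λ, τ)`, meaningful on `shootingDomain`. -/
def F (x : Vec6 × Act n) : Vec6 :=
  r.Λ x.2 (r.Ψ x) r.tip - wrenchOf r.Utip ((r.Ψ x).g r.tip)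

/-- `𝒜 = {(λ, τ) | F(λ, τ) = 0}`. -/
def admissible : Set (Vec6 × Act n) := {x | x ∈ r.shootingDomain ∧ r.F x = 0}

/-- The regular part `{(λ, τ) | F(λ, τ) = 0, rank F_λ(λ, τ) = 6}` of `𝒜`. -/
def regular : Set (Vec6 × Act n) :=
  {x | x ∈ r.admissible ∧
    Module.finrank ℝ (LinearMap.range (fderiv ℝ (fun lam => r.F (lam, x.2)) x.1).toLinearMap) = 6}

end Robot

end ContinuumRobot

end

/-! Everything reduces to one smooth flow. With τ adjoined as a frozen state and the potentials
extended from `SE3` to all matrices, (1) becomes an autonomous smooth field on a linear space; its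
integral curves from the identity stay in `SE3` by themselves. `exists_smooth_flow` gives joint
smoothness on an open domain: solutions on [0, 1] are the fibres over constants of γ ↦ γ - ∫X(γ), a
smooth map of C([0, 1], E) with invertible derivative (a Volterra operator), so the inverse function
theorem applies; rescaling time handles other lengths.

Hence the shooting domain is open and `F` is smooth on it. Where F_λ is invertible, the zero set is
locally a smooth graph λ = φ(τ) (`isLocallySmoothGraph_zeroSet`), and any space topologically
embedded as such a set is a smoothly embedded manifold with coordinate τ
(`exists_chartedSpace_isSmoothEmbedding`).

It remains to see that `Ψ` is a homeomorphism onto its image in the smooth topology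
(`isEmbedding_Ψ`). All s-derivatives of a solution are continuous functions of its state, so
compactness of [0, l] gives continuity. Conversely λ = C u(0), while the tip condition gives Λ_ad(τ)
= W₊(g(l)) - C u(l); the embedding hypothesis then recovers τ continuously. -/

noncomputable section

namespace ContinuumRobot

/-! ### Smoothness of superposition operators on C(K, E). -/

section Nemytskii

variable {K E F : Type*} [TopologicalSpace K] [CompactSpace K]
  [NormedAddCommGroup E] [NormedSpace ℝ E] [NormedAddCommGroup F] [NormedSpace ℝ F]

/-- Pointwise application of a continuous family of operators to a continuous map. -/
def applyFamily : C(K, E →L[ℝ] F) →L[ℝ] C(K, E) →L[ℝ] C(K, F) :=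
  LinearMap.mkContinuous₂
    (LinearMap.mk₂ ℝ (fun (A : C(K, E →L[ℝ] F)) (γ : C(K, E)) =>
        (⟨fun t => A t (γ t), by fun_prop⟩ : C(K, F)))
      (fun _ _ _ => by ext; simp) (fun _ _ _ => by ext; simp)
      (fun _ _ _ => by ext; simp) (fun _ _ _ => by ext; simp)) 1
    (fun A γ => by
      rw [ContinuousMap.norm_le _ (by positivity), one_mul]
      intro t
      exact ((A t).le_opNorm _).trans
        (mul_le_mul (A.norm_coe_le_norm t) (γ.norm_coe_le_norm t) (norm_nonneg _) (norm_nonneg A)))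

@[simp]
lemma applyFamily_apply (A : C(K, E →L[ℝ] F)) (γ : C(K, E)) (t : K) :
    applyFamily A γ t = A t (γ t) := rfl

/-- Mean value inequality at each t, on the segment from γ(t) to γ(t) + h(t). The estimate is
uniform in t because postcomposition with `fderiv ℝ f` is continuous in the sup norm. -/
lemma hasFDerivAt_comp_continuousMap {f : E → F} (hf : ContDiff ℝ 1 f) (γ : C(K, E)) :
    HasFDerivAt (fun γ : C(K, E) => (⟨f, hf.continuous⟩ : C(E, F)).comp γ)
      (applyFamily
        ((⟨fderiv ℝ f, hf.continuous_fderiv one_ne_zero⟩ : C(E, E →L[ℝ] F)).comp γ)) γ := by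
  rw [hasFDerivAt_iff_isLittleO_nhds_zero, Asymptotics.isLittleO_iff]
  intro ε hε
  have hcont : ContinuousAt (fun δ : C(K, E) =>
      (⟨fderiv ℝ f, hf.continuous_fderiv one_ne_zero⟩ : C(E, E →L[ℝ] F)).comp δ) γ :=
    (ContinuousMap.continuous_postcomp _).continuousAt
  obtain ⟨δ, hδ, hball⟩ := (Metric.continuousAt_iff (α := C(K, E)) (β := C(K, E →L[ℝ] F))).1
    hcont ε hε
  filter_upwards [Metric.ball_mem_nhds (0 : C(K, E)) hδ] with h hh
  rw [mem_ball_zero_iff] at hh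
  rw [ContinuousMap.norm_le _ (by positivity)]
  intro t
  have hderiv : ∀ θ ∈ Icc (0 : ℝ) 1,
      ‖fderiv ℝ f (γ t + θ • h t) - fderiv ℝ f (γ t)‖ ≤ ε := by
    intro θ hθ
    have hd : dist (γ + θ • h) γ < δ := by
      rw [dist_eq_norm, add_sub_cancel_left, norm_smul, Real.norm_of_nonneg hθ.1]
      exact (mul_le_of_le_one_left (norm_nonneg _) hθ.2).trans_lt hh
    have := (ContinuousMap.dist_apply_le_dist (f := (⟨fderiv ℝ f, hf.continuous_fderiv one_ne_zero⟩ :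
      C(E, E →L[ℝ] F)).comp (γ + θ • h)) t).trans (hball hd).le
    simpa [dist_eq_norm] using this
  have key := (convex_segment (𝕜 := ℝ) (γ t) (γ t + h t)).norm_image_sub_le_of_norm_hasFDerivWithin_le'
    (f := f) (f' := fderiv ℝ f) (φ := fderiv ℝ f (γ t)) (C := ε)
    (fun x _ => (hf.differentiable one_ne_zero x).hasFDerivAt.hasFDerivWithinAt)
    (fun x hx => by
      rw [segment_eq_image'] at hx
      obtain ⟨θ, hθ, rfl⟩ := hx
      simpa using hderiv θ hθ)
    (left_mem_segment ℝ _ _) (right_mem_segment ℝ _ _)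
  rw [add_sub_cancel_left] at key
  exact key.trans (mul_le_mul_of_nonneg_left (h.norm_coe_le_norm t) hε.le)

end Nemytskii

/-- The derivative is again a superposition operator, with values in operators, followed by the
linear `applyFamily`. The induction must therefore range over all targets `F`. -/
lemma contDiff_nat_comp_continuousMap {K E : Type} [TopologicalSpace K] [CompactSpace K]
    [NormedAddCommGroup E] [NormedSpace ℝ E] (n : ℕ) :
    ∀ {F : Type} [NormedAddCommGroup F] [NormedSpace ℝ F] {f : E → F} (hf : ContDiff ℝ ∞ f),
      ContDiff ℝ n (fun γ : C(K, E) => (⟨f, hf.continuous⟩ : C(E, F)).comp γ) := by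
  induction n with
  | zero =>
    intro F _ _ f hf
    exact contDiff_zero.2 (ContinuousMap.continuous_postcomp _)
  | succ n ih =>
    intro F _ _ f hf
    refine contDiff_succ_iff_hasFDerivAt.2 ⟨_, ?_, fun γ =>
      hasFDerivAt_comp_continuousMap (hf.of_le (by exact_mod_cast le_top)) γ⟩
    exact applyFamily.contDiff.comp (ih (hf.fderiv_right (m := ∞) (by simp)))

/-- Composition with a smooth map is a smooth operator on the space of continuous maps. -/
lemma contDiff_comp_continuousMap {K E F : Type} [TopologicalSpace K] [CompactSpace K]
    [NormedAddCommGroup E] [NormedSpace ℝ E] [NormedAddCommGroup F] [NormedSpace ℝ F]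
    {f : E → F} (hf : ContDiff ℝ ∞ f) :
    ContDiff ℝ ∞ (fun γ : C(K, E) => (⟨f, hf.continuous⟩ : C(E, F)).comp γ) :=
  contDiff_infty.2 fun n => contDiff_nat_comp_continuousMap n hf

/-! ### Integration on [0, 1] and linear Volterra equations. -/

section Volterra

/-- The unit interval as the time domain. -/
abbrev UI : Type := Icc (0 : ℝ) 1

/-- Extension of a map on `[0, 1]` to the line by constants. -/
abbrev extendUI {E : Type*} [TopologicalSpace E] (γ : C(UI, E)) (s : ℝ) : E :=
  γ (projIcc 0 1 zero_le_one s)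

lemma continuous_extendUI {E : Type*} [TopologicalSpace E] (γ : C(UI, E)) : Continuous (extendUI γ) :=
  γ.continuous.comp continuous_projIcc

variable {E : Type*} [NormedAddCommGroup E] [NormedSpace ℝ E]

lemma hasDerivAt_integral_extendUI [CompleteSpace E] (γ : C(UI, E)) (t : ℝ) :
    HasDerivAt (fun t => ∫ s in (0 : ℝ)..t, extendUI γ s) (extendUI γ t) t :=
  (continuous_extendUI γ).integral_hasStrictDerivAt 0 t |>.hasDerivAt

/-- The operator `γ ↦ ∫₀ᵗ γ` on `C([0, 1], E)`. -/
def primitive : C(UI, E) →L[ℝ] C(UI, E) :=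
  LinearMap.mkContinuous
    { toFun := fun γ => ⟨fun t => ∫ s in (0 : ℝ)..t, extendUI γ s,
        (intervalIntegral.continuous_primitive
          (fun _ _ => (continuous_extendUI γ).intervalIntegrable _ _) 0).comp continuous_subtype_val⟩
      map_add' := fun γ δ => by
        ext t
        exact intervalIntegral.integral_add ((continuous_extendUI γ).intervalIntegrable _ _)
          ((continuous_extendUI δ).intervalIntegrable _ _)
      map_smul' := fun c γ => by
        ext t
        exact intervalIntegral.integral_smul c (extendUI γ) } 1
    (fun γ => by
      rw [one_mul, ContinuousMap.norm_le _ (norm_nonneg _)]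
      intro t
      refine (intervalIntegral.norm_integral_le_of_norm_le_const (C := ‖γ‖)
        fun s _ => γ.norm_coe_le_norm _).trans ?_
      rw [sub_zero, abs_of_nonneg t.2.1]
      exact mul_le_of_le_one_right (norm_nonneg _) t.2.2)

lemma primitive_apply (γ : C(UI, E)) (t : UI) :
    primitive γ t = ∫ s in (0 : ℝ)..t, extendUI γ s := rfl

/-- Integrating the bound s ^ k contributes a factor t / (k + 1) at each step, whence the factorial;
some power of the operator is then a strict contraction whatever the size of `A`. -/
lemma norm_volterra_pow_le (A : C(UI, E →L[ℝ] E)) (k : ℕ) (γ : C(UI, E)) (t : UI) :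
    ‖((primitive.comp (applyFamily A)) ^ k) γ t‖ ≤ (‖A‖ * t) ^ k / k.factorial * ‖γ‖ := by
  induction k generalizing t with
  | zero => simpa using γ.norm_coe_le_norm t
  | succ k ih =>
    rw [pow_succ', mul_apply_eq_comp, ContinuousLinearMap.comp_apply, primitive_apply]
    have hb : ∀ s ∈ Icc (0 : ℝ) t,
        ‖extendUI (applyFamily A (((primitive.comp (applyFamily A)) ^ k) γ)) s‖ ≤
          ‖A‖ ^ (k + 1) / k.factorial * ‖γ‖ * s ^ k := by
      intro s hs
      have hs1 : s ∈ Icc (0 : ℝ) 1 := ⟨hs.1, hs.2.trans t.2.2⟩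
      rw [extendUI, projIcc_of_mem _ hs1, applyFamily_apply]
      refine ((A _).le_opNorm _).trans
        ((mul_le_mul (A.norm_coe_le_norm _) (ih _) (norm_nonneg _) (norm_nonneg _)).trans_eq ?_)
      simp only [mul_pow]
      ring
    refine (intervalIntegral.norm_integral_le_of_norm_le t.2.1
      (Filter.Eventually.of_forall fun s hs => hb s (Ioc_subset_Icc_self hs))
      (Continuous.intervalIntegrable (by fun_prop) _ _)).trans_eq ?_
    rw [intervalIntegral.integral_const_mul, integral_pow, Nat.factorial_succ]
    push_cast
    field_simp
    ring

/-- A linear Volterra equation of the second kind is uniquely solvable. -/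
lemma isUnit_one_sub_volterra [CompleteSpace E] (A : C(UI, E →L[ℝ] E)) :
    IsUnit (1 - primitive.comp (applyFamily A) : C(UI, E) →L[ℝ] C(UI, E)) := by
  set L : C(UI, E) →L[ℝ] C(UI, E) := primitive.comp (applyFamily A)
  have hlim := FloorSemiring.tendsto_pow_div_factorial_atTop ‖A‖
  obtain ⟨k, hk⟩ := (hlim.eventually (gt_mem_nhds one_pos)).exists
  have hnorm : ‖L ^ k‖ < 1 := by
    refine (ContinuousLinearMap.opNorm_le_bound _ (by positivity) fun γ => ?_).trans_lt hk
    rw [ContinuousMap.norm_le _ (by positivity)]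
    intro t
    refine (norm_volterra_pow_le A k γ t).trans ?_
    have ht := t.2.1
    gcongr
    exact mul_le_of_le_one_right (norm_nonneg A) t.2.2
  have hu : IsUnit (1 - L ^ k) := (Units.oneSub (L ^ k) hnorm).isUnit
  -- 1 - L ^ k is the product of 1 - L and a geometric sum; commuting factors of a unit are units.
  have hcomm : Commute (1 - L) (∑ i ∈ Finset.range k, L ^ i) :=
    Commute.sum_right _ _ _ fun i _ => ((Commute.one_left _).sub_left ((Commute.refl L).pow_right i))
  rw [← mul_neg_geom_sum, hcomm.isUnit_mul_iff] at hu
  exact hu.1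

end Volterra

/-! ### Uniqueness of integral curves. -/

section Uniqueness

variable {E : Type*} [NormedAddCommGroup E] [NormedSpace ℝ E]

/-- Uniqueness of integral curves of a `C¹` vector field on a compact interval. -/
lemma eqOn_Icc_of_isIntegralCurveOn {X : E → E} (hX : ContDiff ℝ 1 X) {T : ℝ} {γ δ : ℝ → E}
    (hγ : IsIntegralCurveOn γ (fun _ => X) (Icc 0 T))
    (hδ : IsIntegralCurveOn δ (fun _ => X) (Icc 0 T)) (h0 : γ 0 = δ 0) :
    EqOn γ δ (Icc 0 T) := by
  -- The segments joining the two curves sweep out a compact set, on which the derivative of X is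
  -- bounded; this is the constant in Grönwall's inequality.
  obtain ⟨L, hL⟩ : ∃ L, ∀ p ∈ Icc 0 T ×ˢ Icc (0 : ℝ) 1,
      ‖fderiv ℝ X (δ p.1 + p.2 • (γ p.1 - δ p.1))‖ ≤ L := by
    refine (isCompact_Icc.prod isCompact_Icc).exists_bound_of_continuousOn ?_
    have h1 : ContinuousOn (fun p : ℝ × ℝ => γ p.1) (Icc 0 T ×ˢ Icc (0 : ℝ) 1) :=
      hγ.continuousOn.comp continuousOn_fst fun p hp => hp.1
    have h2 : ContinuousOn (fun p : ℝ × ℝ => δ p.1) (Icc 0 T ×ˢ Icc (0 : ℝ) 1) :=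
      hδ.continuousOn.comp continuousOn_fst fun p hp => hp.1
    exact (hX.continuous_fderiv one_ne_zero).comp_continuousOn
      (h2.add (continuousOn_snd.smul (h1.sub h2)))
  have hder : ∀ {η : ℝ → E}, IsIntegralCurveOn η (fun _ => X) (Icc 0 T) → ∀ t ∈ Ico 0 T,
      HasDerivWithinAt η (X (η t)) (Ici t) t := fun hη t ht =>
    (hη t (Ico_subset_Icc_self ht)).mono_of_mem_nhdsWithin (Icc_mem_nhdsGE_of_mem ht)
  have hz := eq_zero_of_abs_deriv_le_mul_abs_self_of_eq_zero_right (f := γ - δ)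
    (f' := fun t => X (γ t) - X (δ t)) (K := L) (hγ.continuousOn.sub hδ.continuousOn)
    (fun t ht => (hder hγ t ht).sub (hder hδ t ht)) (by simp [h0]) fun t ht => by
      refine (convex_segment (𝕜 := ℝ) (δ t) (γ t)).norm_image_sub_le_of_norm_fderiv_le (𝕜 := ℝ)
        (fun x _ => hX.differentiable one_ne_zero x) (fun x hx => ?_)
        (left_mem_segment ℝ _ _) (right_mem_segment ℝ _ _)
      rw [segment_eq_image'] at hx
      obtain ⟨θ, hθ, rfl⟩ := hx
      exact hL (t, θ) ⟨Ico_subset_Icc_self ht, hθ⟩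
  exact fun t ht => sub_eq_zero.1 (hz t ht)

end Uniqueness

/-! ### Smooth dependence of unit-time solutions on the initial value. -/

section Picard

variable {E : Type} [NormedAddCommGroup E] [NormedSpace ℝ E]

/-- The map `γ ↦ γ - ∫₀ᵗ X(γ)`; its fibre over the constant `z` consists of the solution of
`γ' = X(γ)` on `[0, 1]` with `γ(0) = z`. -/
def picard {X : E → E} (hX : ContDiff ℝ ∞ X) (γ : C(UI, E)) : C(UI, E) :=
  γ - primitive ((⟨X, hX.continuous⟩ : C(E, E)).comp γ)

variable {X : E → E} (hX : ContDiff ℝ ∞ X)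

lemma contDiff_picard : ContDiff ℝ ∞ (picard hX) :=
  contDiff_id.sub (primitive.contDiff.comp (contDiff_comp_continuousMap hX))

/-- The initial values of the integral curves that exist on `[0, 1]`. -/
def unitTimeDomain : Set E := {z | ∃ γ, picard hX γ = ContinuousMap.const UI z}

open Classical in
/-- The integral curve on `[0, 1]` with a given initial value. -/
def unitTimeSolution (z : E) : C(UI, E) :=
  if h : z ∈ unitTimeDomain hX then h.choose else 0

lemma picard_unitTimeSolution {z : E} (h : z ∈ unitTimeDomain hX) :
    picard hX (unitTimeSolution hX z) = ContinuousMap.const UI z := by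
  rw [unitTimeSolution, dif_pos h]
  exact h.choose_spec

variable [CompleteSpace E]

/-- The derivative is the identity minus the Volterra operator with kernel DX ∘ γ, hence invertible.
-/
lemma exists_hasFDerivAt_picard (γ : C(UI, E)) :
    ∃ f' : C(UI, E) ≃L[ℝ] C(UI, E), HasFDerivAt (picard hX) (f' : C(UI, E) →L[ℝ] C(UI, E)) γ := by
  have hX1 : ContDiff ℝ 1 X := hX.of_le (by exact_mod_cast le_top)
  obtain ⟨u, hu⟩ := isUnit_one_sub_volterra
    ((⟨fderiv ℝ X, hX1.continuous_fderiv one_ne_zero⟩ : C(E, E →L[ℝ] E)).comp γ)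
  refine ⟨ContinuousLinearEquiv.unitsEquiv ℝ _ u, ?_⟩
  have h : HasFDerivAt (picard hX) (u : C(UI, E) →L[ℝ] C(UI, E)) γ := by
    rw [hu]
    exact (hasFDerivAt_id γ).sub (HasFDerivAt.comp (g := primitive) γ
      (ContinuousLinearMap.hasFDerivAt _) (hasFDerivAt_comp_continuousMap hX1 γ))
  exact h

lemma picard_eq_const_iff (γ : C(UI, E)) (z : E) :
    picard hX γ = ContinuousMap.const UI z ↔
      IsIntegralCurveOn (extendUI γ) (fun _ => X) (Icc 0 1) ∧ extendUI γ 0 = z := by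
  have hd := hasDerivAt_integral_extendUI ((⟨X, hX.continuous⟩ : C(E, E)).comp γ)
  constructor
  · intro h
    have hγ : ∀ t ∈ Icc (0 : ℝ) 1, extendUI γ t =
        z + ∫ s in (0 : ℝ)..t, extendUI ((⟨X, hX.continuous⟩ : C(E, E)).comp γ) s := by
      intro t ht
      have := congrArg (fun δ : C(UI, E) => δ ⟨t, ht⟩) h
      simp only [picard, ContinuousMap.sub_apply, primitive_apply, ContinuousMap.const_apply] at this
      rw [← this, extendUI, projIcc_of_mem _ ht]
      abel
    refine ⟨fun t ht => ?_, by simpa using hγ 0 (by simp)⟩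
    exact (((hd t).const_add z).hasDerivWithinAt).congr hγ (hγ t ht)
  · rintro ⟨h, h0⟩
    ext t
    have := intervalIntegral.integral_eq_sub_of_hasDeriv_right_of_le (f := extendUI γ)
      (f' := extendUI ((⟨X, hX.continuous⟩ : C(E, E)).comp γ)) t.2.1
      (continuous_extendUI γ).continuousOn (fun s hs => by
        have hs1 : s ∈ Ioo (0 : ℝ) 1 := ⟨hs.1, hs.2.trans_le t.2.2⟩
        exact ((h s (Ioo_subset_Icc_self hs1)).hasDerivAt
          (Icc_mem_nhds hs1.1 hs1.2)).hasDerivWithinAt)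
      ((continuous_extendUI _).intervalIntegrable _ _)
    simp only [picard, ContinuousMap.sub_apply, primitive_apply, ContinuousMap.const_apply, this,
      h0]
    simp [extendUI]

lemma eq_of_picard_eq_const {γ δ : C(UI, E)} {z : E}
    (hγ : picard hX γ = ContinuousMap.const UI z) (hδ : picard hX δ = ContinuousMap.const UI z) :
    γ = δ := by
  rw [picard_eq_const_iff] at hγ hδ
  ext t
  have := eqOn_Icc_of_isIntegralCurveOn (hX.of_le (by exact_mod_cast le_top)) hγ.1 hδ.1
    (hγ.2.trans hδ.2.symm) t.2
  simpa [extendUI] using this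

/-- The local inverse of `picard` at the solution, applied to nearby constants, solves nearby
problems and depends smoothly on the constant. Uniqueness identifies it with the chosen solution. -/
lemma unitTimeDomain_mem_nhds_and_contDiffAt {z : E} (hz : z ∈ unitTimeDomain hX) :
    unitTimeDomain hX ∈ 𝓝 z ∧ ContDiffAt ℝ ∞ (unitTimeSolution hX) z := by
  set γ := unitTimeSolution hX z
  have hγ : picard hX γ = ContinuousMap.const UI z := picard_unitTimeSolution hX hz
  obtain ⟨f', hf'⟩ := exists_hasFDerivAt_picard hX γ
  have hc : ContDiffAt ℝ ∞ (picard hX) γ := (contDiff_picard hX).contDiffAt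
  have hn : (∞ : WithTop ℕ∞) ≠ 0 := by simp
  have hconst : ContDiff ℝ ∞ (fun w : E => ContinuousMap.const UI w) :=
    (ContinuousLinearMap.const ℝ UI : E →L[ℝ] C(UI, E)).contDiff
  have hsolve : ∀ᶠ w in 𝓝 z,
      picard hX (hc.localInverse hf' hn (ContinuousMap.const UI w)) = ContinuousMap.const UI w := by
    have ht : (hc.toOpenPartialHomeomorph (picard hX) hf' hn).target ∈
        𝓝 (ContinuousMap.const UI z) := by
      rw [← hγ]
      exact (hc.toOpenPartialHomeomorph (picard hX) hf' hn).open_target.mem_nhds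
        (hc.image_mem_toOpenPartialHomeomorph_target hf' hn)
    filter_upwards [hconst.continuous.continuousAt.preimage_mem_nhds ht] with w hw
    exact (hc.toOpenPartialHomeomorph (picard hX) hf' hn).right_inv hw
  refine ⟨hsolve.mono fun w hw => ⟨_, hw⟩, ?_⟩
  have hloc : ContDiffAt ℝ ∞ (fun w => hc.localInverse hf' hn (ContinuousMap.const UI w)) z := by
    have h1 := hc.to_localInverse hf' hn
    rw [hγ] at h1
    exact h1.comp z hconst.contDiffAt
  refine hloc.congr_of_eventuallyEq (hsolve.mono fun w hw => ?_)
  exact eq_of_picard_eq_const hX (picard_unitTimeSolution hX ⟨_, hw⟩) hw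

end Picard

/-! ### The smooth flow of a vector field. -/

section Flow

variable {E : Type} [NormedAddCommGroup E] [NormedSpace ℝ E] [CompleteSpace E]

/-- The flow of a smooth vector field is smooth, jointly in time and initial value, on its
maximal domain, which is open. -/
theorem exists_smooth_flow {X : E → E} (hX : ContDiff ℝ ∞ X) :
    ∃ (O : Set (E × ℝ)) (Φ : E × ℝ → E), IsOpen O ∧ ContDiffOn ℝ ∞ Φ O ∧
      (∀ z T, 0 < T → (z, T) ∈ O →
        IsIntegralCurveOn (fun t => Φ (z, t)) (fun _ => X) (Icc 0 T) ∧ Φ (z, 0) = z) ∧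
      (∀ T γ, IsIntegralCurveOn γ (fun _ => X) (Icc 0 T) →
        ∀ t ∈ Icc 0 T, (γ 0, t) ∈ O ∧ Φ (γ 0, t) = γ t) := by
  -- Time becomes part of the initial value: the unit-time solution of z' = T X(z), T' = 0 ends at
  -- the time-T flow of X.
  have hY : ContDiff ℝ ∞ (fun p : E × ℝ => (p.2 • X p.1, (0 : ℝ))) := by fun_prop
  have hcurve : ∀ T γ, IsIntegralCurveOn γ (fun _ => X) (Icc 0 T) → ∀ t ∈ Icc 0 T,
      (γ 0, t) ∈ unitTimeDomain hY ∧ (unitTimeSolution hY (γ 0, t) 1).1 = γ t := by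
    intro T γ hγ t ht
    have hmaps : MapsTo (fun s => t * s) (Icc (0 : ℝ) 1) (Icc 0 T) := fun s hs =>
      ⟨mul_nonneg ht.1 hs.1, (mul_le_of_le_one_right ht.1 hs.2).trans ht.2⟩
    have hcont : ContinuousOn (fun s => (γ (t * s), t)) (Icc (0 : ℝ) 1) :=
      (hγ.continuousOn.comp (by fun_prop) hmaps).prodMk continuousOn_const
    let η : C(UI, E × ℝ) := ⟨fun s => (γ (t * s), t), continuousOn_iff_continuous_domRestrict.1 hcont⟩
    have hη : ∀ s ∈ Icc (0 : ℝ) 1, extendUI η s = (γ (t * s), t) := fun s hs => by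
      rw [extendUI, projIcc_of_mem _ hs]; rfl
    have hsol : picard hY η = ContinuousMap.const UI (γ 0, t) := by
      rw [picard_eq_const_iff]
      refine ⟨fun s hs => ?_, by rw [hη 0 (by simp), mul_zero]⟩
      rw [hη s hs]
      refine HasDerivWithinAt.congr ?_ hη (hη s hs)
      refine HasDerivWithinAt.prodMk ?_ (hasDerivWithinAt_const _ _ _)
      have hlin : HasDerivWithinAt (fun s : ℝ => t * s) t (Icc 0 1) s := by
        simpa using (hasDerivWithinAt_id s (Icc (0 : ℝ) 1)).const_mul t
      exact (hγ (t * s) (hmaps hs)).scomp s hlin hmaps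
    refine ⟨⟨η, hsol⟩, ?_⟩
    rw [eq_of_picard_eq_const hY (picard_unitTimeSolution hY ⟨η, hsol⟩) hsol]
    change γ (t * ((1 : UI) : ℝ)) = γ t
    rw [Icc.coe_one, mul_one]
  refine ⟨unitTimeDomain hY, fun p => (unitTimeSolution hY p 1).1, ?_, ?_, ?_, hcurve⟩
  · exact isOpen_iff_mem_nhds.2 fun p hp => (unitTimeDomain_mem_nhds_and_contDiffAt hY hp).1
  · intro p hp
    have hev : ContDiff ℝ ∞ (fun γ : C(UI, E × ℝ) => (γ 1).1) :=
      contDiff_fst.comp (ContinuousMap.evalCLM ℝ (1 : UI) : C(UI, E × ℝ) →L[ℝ] E × ℝ).contDiff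
    exact (hev.contDiffAt.comp p
      (unitTimeDomain_mem_nhds_and_contDiffAt hY hp).2).contDiffWithinAt
  · intro z T hT hzT
    obtain ⟨hη, hη0⟩ := (picard_eq_const_iff hY _ _).1 (picard_unitTimeSolution hY hzT)
    set η := extendUI (unitTimeSolution hY (z, T))
    have hσ : ∀ s ∈ Icc (0 : ℝ) 1, (η s).2 = T := by
      have hd : ∀ s ∈ Ico (0 : ℝ) 1, HasDerivWithinAt (fun s => (η s).2) 0 (Ici s) s :=
        fun s hs => ((hη s (Ico_subset_Icc_self hs)).mono_of_mem_nhdsWithin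
          (Icc_mem_nhdsGE_of_mem hs)).snd
      intro s hs
      exact (constant_of_has_deriv_right_zero (continuous_snd.comp_continuousOn hη.continuousOn)
        hd s hs).trans (congrArg Prod.snd hη0)
    have hγ : IsIntegralCurveOn (fun t => (η (T⁻¹ * t)).1) (fun _ => X) (Icc 0 T) := by
      intro t ht
      have hmaps : MapsTo (fun t => T⁻¹ * t) (Icc 0 T) (Icc (0 : ℝ) 1) := fun t ht =>
        ⟨mul_nonneg (inv_nonneg.2 hT.le) ht.1, by
          rw [inv_mul_le_iff₀ hT, mul_one]; exact ht.2⟩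
      have hlin : HasDerivWithinAt (fun s : ℝ => T⁻¹ * s) T⁻¹ (Icc 0 T) t := by
        simpa using (hasDerivWithinAt_id t (Icc (0 : ℝ) T)).const_mul T⁻¹
      have hfst : HasDerivWithinAt (fun s => (η s).1) ((η (T⁻¹ * t)).2 • X (η (T⁻¹ * t)).1)
          (Icc 0 1) (T⁻¹ * t) := (ContinuousLinearMap.fst ℝ E ℝ).hasFDerivAt.comp_hasDerivWithinAt _
        (hη _ (hmaps ht))
      rw [hσ _ (hmaps ht)] at hfst
      have h := hfst.scomp t hlin hmaps
      rw [smul_smul, inv_mul_cancel₀ hT.ne', one_smul] at h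
      exact h
    have hγ0 : (η (T⁻¹ * 0)).1 = z := by rw [mul_zero, hη0]
    have hflow := hcurve T _ hγ
    simp only [hγ0] at hflow
    refine ⟨fun t ht => ?_, ?_⟩
    · have := (hγ t ht).congr (fun s hs => (hflow s hs).2) (hflow t ht).2
      simpa only [(hflow t ht).2] using this
    · simpa only [hγ0] using (hflow 0 ⟨le_rfl, hT.le⟩).2

end Flow

/-! ### The group SE(3): invariance, extension of potentials, wrenches. -/

section SE3

lemma mem_SE3_iff {M : Mat4} :
    M ∈ SE3 ↔ M.toBlocks₁₁ * M.toBlocks₁₁ᵀ = 1 ∧ M.toBlocks₁₁.det = 1 ∧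
      M.toBlocks₂₁ = 0 ∧ M.toBlocks₂₂ = 1 := by
  constructor
  · rintro ⟨R, hR, p, rfl⟩
    rw [Matrix.mem_specialOrthogonalGroup_iff, Matrix.mem_orthogonalGroup_iff] at hR
    simpa using hR
  · rintro ⟨h1, h2, h3, h4⟩
    refine ⟨M.toBlocks₁₁, ?_, M.toBlocks₁₂, ?_⟩
    · rw [Matrix.mem_specialOrthogonalGroup_iff, Matrix.mem_orthogonalGroup_iff]
      exact ⟨h1, h2⟩
    · rw [← h3, ← h4, Matrix.fromBlocks_toBlocks]

lemma isClosed_setOf_of_mem_SE3 : IsClosed {a : Arr | Matrix.of a ∈ SE3} := by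
  simp only [mem_SE3_iff]
  have h : ∀ {p q : Type} (f : p → Fin 3 ⊕ Fin 1) (k : q → Fin 3 ⊕ Fin 1),
      Continuous fun a : Arr => (Matrix.of fun i j => a (f i) (k j) : Matrix p q ℝ) := fun f k =>
    continuous_matrix fun i j => by simp only [Matrix.of_apply]; fun_prop
  have h11 := h (Sum.inl : Fin 3 → _) (Sum.inl : Fin 3 → _)
  refine (isClosed_eq (h11.matrix_mul h11.matrix_transpose) continuous_const).inter
    ((isClosed_eq h11.matrix_det continuous_const).inter
    ((isClosed_eq (h Sum.inr Sum.inl) continuous_const).inter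
      (isClosed_eq (h Sum.inr Sum.inr) continuous_const)))

lemma eq_of_hasDerivWithinAt_zero {E : Type*} [NormedAddCommGroup E] [NormedSpace ℝ E] {T : ℝ}
    {f : ℝ → E} (hf : ∀ s ∈ Icc 0 T, HasDerivWithinAt f 0 (Icc 0 T) s) :
    ∀ s ∈ Icc 0 T, f s = f 0 :=
  constant_of_has_deriv_right_zero (fun s hs => (hf s hs).continuousWithinAt) fun s hs =>
    (hf s (Ico_subset_Icc_self hs)).mono_of_mem_nhdsWithin (Icc_mem_nhdsGE_of_mem hs)

/-- A curve of matrices with `g' = g ξ̂` that starts at the identity stays in `SE(3)`. -/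
lemma mem_SE3_of_hasDerivWithinAt {T : ℝ} {g : ℝ → Mat4} {ξ : ℝ → Vec6} (h0 : g 0 = 1)
    (h : ∀ s ∈ Icc 0 T, HasDerivWithinAt (fun s => entries (g s)) (entries (g s * hat (ξ s)))
      (Icc 0 T) s) :
    ∀ s ∈ Icc 0 T, g s ∈ SE3 := by
  have hent : ∀ s ∈ Icc 0 T, ∀ i j,
      HasDerivWithinAt (fun s => g s i j) ((g s * hat (ξ s)) i j) (Icc 0 T) s := fun s hs i j =>
    hasDerivWithinAt_pi.1 (hasDerivWithinAt_pi.1 (h s hs) i) j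
  -- The rows of g, cut to three entries, have constant inner products since ω̂ is skew and the last
  -- row of `hat` vanishes. Including the fourth row shows that its first three entries remain zero.
  have hgram : ∀ i j, ∀ s ∈ Icc 0 T, ∑ k : Fin 3, g s i (.inl k) * g s j (.inl k) =
      ∑ k : Fin 3, g 0 i (.inl k) * g 0 j (.inl k) := by
    intro i j
    refine eq_of_hasDerivWithinAt_zero fun s hs => ?_
    have hd := HasDerivWithinAt.fun_sum (u := Finset.univ) fun (k : Fin 3) _ =>
      (hent s hs i (.inl k)).mul (hent s hs j (.inl k))
    refine hd.congr_deriv ?_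
    simp [Matrix.mul_apply, hat, hat3, Fin.sum_univ_three]
    ring
  have hbot : ∀ s ∈ Icc 0 T, ∀ k : Fin 3, g s (.inr 0) (.inl k) = 0 := by
    intro s hs k
    have := hgram (.inr 0) (.inr 0) s hs
    simp only [h0, ne_eq, reduceCtorEq, not_false_eq_true, Matrix.one_apply_ne, mul_zero,
      Finset.sum_const_zero] at this
    exact mul_self_eq_zero.1 ((Finset.sum_eq_zero_iff_of_nonneg fun _ _ => mul_self_nonneg _).1
      this k (Finset.mem_univ _))
  have hcorner : ∀ s ∈ Icc 0 T, g s (.inr 0) (.inr 0) = g 0 (.inr 0) (.inr 0) := by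
    refine eq_of_hasDerivWithinAt_zero fun s hs => (hent s hs _ _).congr_deriv ?_
    simp [Matrix.mul_apply, hat, hbot s hs]
  have horth : ∀ s ∈ Icc 0 T, (g s).toBlocks₁₁ * (g s).toBlocks₁₁ᵀ = 1 := by
    intro s hs
    ext i j
    rw [Matrix.mul_apply]
    refine (hgram (.inl i) (.inl j) s hs).trans ?_
    simp [h0, Matrix.one_apply]
  have hdetcont : ContinuousOn (fun s => (g s).toBlocks₁₁.det) (Icc 0 T) := by
    have : ContinuousOn (fun s => (g s).toBlocks₁₁) (Icc 0 T) :=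
      continuousOn_pi.2 fun i => continuousOn_pi.2 fun j => fun s hs =>
        (hent s hs (.inl i) (.inl j)).continuousWithinAt
    exact (continuous_id.matrix_det).comp_continuousOn this
  intro s hs
  have hT : (0 : ℝ) ≤ T := hs.1.trans hs.2
  -- Orthogonality gives det² = 1; continuity and the value at 0 exclude -1.
  have hdet := isPreconnected_Icc.eq_of_sq_eq hdetcont (continuousOn_const (c := (1 : ℝ)))
    (fun s hs => by
      have := congrArg Matrix.det (horth s hs)
      rw [Matrix.det_mul, Matrix.det_transpose, Matrix.det_one] at this
      simpa [sq] using this)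
    (fun _ => one_ne_zero) (left_mem_Icc.2 hT) (by
      have : (1 : Mat4).toBlocks₁₁ = 1 := by ext i j; simp [Matrix.toBlocks₁₁, Matrix.one_apply]
      simp [h0, this]) hs
  refine mem_SE3_iff.2 ⟨horth s hs, hdet, ?_, ?_⟩
  · ext i j
    rw [Subsingleton.elim i 0]
    exact hbot s hs j
  · ext i j
    rw [Subsingleton.elim i 0, Subsingleton.elim j 0]
    refine (hcorner s hs).trans ?_
    simp [h0]

lemma mul_mem_SE3 {M N : Mat4} (hM : M ∈ SE3) (hN : N ∈ SE3) : M * N ∈ SE3 := by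
  obtain ⟨R, hR, p, rfl⟩ := hM
  obtain ⟨S, hS, q, rfl⟩ := hN
  exact ⟨R * S, mul_mem hR hS, R * q + p, by simp [Matrix.fromBlocks_multiply]⟩

-- The exponential is differentiated in the operator norm; the linear map `entries`, continuous in
-- finite dimension, carries the result to `Arr`.
open scoped Matrix.Norms.Operator in
lemma hasDerivAt_entries_mul_exp (M A : Mat4) (t : ℝ) :
    HasDerivAt (fun t : ℝ => entries (M * NormedSpace.exp (t • A)))
      (entries (M * NormedSpace.exp (t • A) * A)) t := by
  have h : HasDerivAt (fun t : ℝ => M * NormedSpace.exp (t • A))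
      (M * (NormedSpace.exp (t • A) * A)) t := (hasDerivAt_exp_smul_const A t).const_mul M
  rw [← mul_assoc] at h
  let L : Mat4 →ₗ[ℝ] Arr := { toFun := entries, map_add' := fun _ _ => rfl, map_smul' := fun _ _ => rfl }
  exact (LinearMap.toContinuousLinearMap L).hasFDerivAt.comp_hasDerivAt t h

lemma hat_neg (ξ : Vec6) : hat (-ξ) = -hat ξ := by
  ext i j
  rcases i with i | i <;> rcases j with j | j
  · fin_cases i <;> fin_cases j <;> simp [hat, hat3]
  all_goals simp [hat]

lemma exp_smul_hat_mem_SE3 (ζ : Vec6) (t : ℝ) : NormedSpace.exp (t • hat ζ) ∈ SE3 := by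
  have key : ∀ (ζ : Vec6) (t : ℝ), 0 ≤ t → NormedSpace.exp (t • hat ζ) ∈ SE3 := fun ζ t ht =>
    mem_SE3_of_hasDerivWithinAt (g := fun t => NormedSpace.exp (t • hat ζ)) (ξ := fun _ => ζ)
      (by simp) (fun s _ => by
        simpa using (hasDerivAt_entries_mul_exp 1 (hat ζ) s).hasDerivWithinAt) t ⟨ht, le_rfl⟩
  rcases le_total 0 t with ht | ht
  · exact key ζ t ht
  · simpa [hat_neg] using key (-ζ) (-t) (by linarith)

/-- A smooth function on `SE(3)` is the restriction of a smooth function on all matrices. -/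
lemma SmoothOnSE3.exists_contDiff {f : SE3 → ℝ} (hf : SmoothOnSE3 f) :
    ∃ F : Arr → ℝ, ContDiff ℝ ∞ F ∧ ∀ h : SE3, f h = F (entries h) := by
  -- A partition of unity glues the local extensions: the prescribed values form a single point on
  -- `SE3` and the whole line off it, both convex. Off the closed set `SE3` the local choice is 0.
  obtain ⟨G, hG⟩ := exists_contMDiffMap_forall_mem_convex_of_local (M := Arr) (F := ℝ) (n := ⊤)
    𝓘(ℝ, Arr) (t := fun a => {y | ∀ h : SE3, entries h = a → y = f h})
    (fun a x hx y hy α β _ _ hαβ h hh => by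
      rw [hx h hh, hy h hh, ← add_smul, hαβ, one_smul])
    (fun a => by
      by_cases ha : Matrix.of a ∈ SE3
      · obtain ⟨V, hV, haV, F, hF, hfF⟩ := hf ⟨_, ha⟩
        exact ⟨V, hV.mem_nhds haV, F, hF.contMDiffOn, fun y hy h hh => by
          rw [hfF h (hh ▸ hy), hh]⟩
      · exact ⟨_, isClosed_setOf_of_mem_SE3.isOpen_compl.mem_nhds ha, fun _ => 0, contMDiffOn_const,
          fun y hy h hh => absurd (hh ▸ h.2 : Matrix.of y ∈ SE3) hy⟩)
  exact ⟨G, G.contMDiff.contDiff, fun h => (hG _ h rfl).symm⟩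

/-- The wrench of a smooth potential on all matrices. -/
def ambientWrench (F : Arr → ℝ) (a : Arr) : Vec6 := fun i =>
  - fderiv ℝ F a (entries (Matrix.of a * hat (Pi.single i 1)))

lemma contDiff_ambientWrench {F : Arr → ℝ} (hF : ContDiff ℝ ∞ F) :
    ContDiff ℝ ∞ (ambientWrench F) := by
  refine contDiff_pi.2 fun i => ContDiff.neg ?_
  refine (hF.fderiv_right (m := ∞) (by simp)).clm_apply ?_
  refine contDiff_pi.2 fun j => contDiff_pi.2 fun k => ?_
  simp only [entries, Matrix.mul_apply, Matrix.of_apply]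
  fun_prop

/-- The curve g exp(t ζ̂) stays in `SE3`, so along it the extension by zero agrees with `F` and the
chain rule applies. -/
lemma wrenchOf_eq_ambientWrench {f : SE3 → ℝ} {F : Arr → ℝ} (hF : ContDiff ℝ ∞ F)
    (hfF : ∀ h : SE3, f h = F (entries h)) (g : SE3) :
    wrenchOf f g = ambientWrench F (entries g) := by
  ext i
  have hd := hasDerivAt_entries_mul_exp g (hat (Pi.single i 1)) 0
  rw [zero_smul, NormedSpace.exp_zero, mul_one] at hd
  have hc : (fun t : ℝ => extendSE3 f ((g : Mat4) * NormedSpace.exp (t • hat (Pi.single i 1)))) =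
      fun t => F (entries ((g : Mat4) * NormedSpace.exp (t • hat (Pi.single i 1)))) := by
    funext t
    have hmem := mul_mem_SE3 g.2 (exp_smul_hat_mem_SE3 (Pi.single i 1) t)
    rw [extendSE3, dif_pos hmem, hfF]
  have hF' := (hF.differentiable (by simp) (entries g)).hasFDerivAt
  have hcomp : HasDerivAt (fun t : ℝ =>
      F (entries ((g : Mat4) * NormedSpace.exp (t • hat (Pi.single i 1)))))
      (fderiv ℝ F (entries g) (entries ((g : Mat4) * hat (Pi.single i 1)))) 0 := by
    refine HasFDerivAt.comp_hasDerivAt 0 ?_ hd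
    simpa using hF'
  rw [wrenchOf, hc, hcomp.deriv]
  rfl

end SE3

/-! ### Derivatives along integral curves. -/

section LieDerivative

variable {E F : Type*} [NormedAddCommGroup E] [NormedSpace ℝ E]
  [NormedAddCommGroup F] [NormedSpace ℝ F]

/-- The iterated derivative of a map `p` along a vector field `X`. -/
def iteratedLieDeriv (X : E → E) (p : E → F) : ℕ → E → F
  | 0 => p
  | k + 1 => fun z => fderiv ℝ (iteratedLieDeriv X p k) z (X z)

lemma contDiff_iteratedLieDeriv {X : E → E} (hX : ContDiff ℝ ∞ X) {p : E → F}
    (hp : ContDiff ℝ ∞ p) (k : ℕ) : ContDiff ℝ ∞ (iteratedLieDeriv X p k) := by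
  induction k with
  | zero => exact hp
  | succ k ih => exact (ih.fderiv_right (m := ∞) (by simp)).clm_apply hX

/-- Repeated chain rule. Every s-derivative thus becomes a fixed smooth function of the state, so
convergence of states controls the smooth topology. -/
lemma iteratedDerivWithin_comp_integralCurve {X : E → E} (hX : ContDiff ℝ ∞ X) {p : E → F}
    (hp : ContDiff ℝ ∞ p) {T : ℝ} (hT : 0 < T) {γ : ℝ → E}
    (hγ : IsIntegralCurveOn γ (fun _ => X) (Icc 0 T)) (k : ℕ) :
    EqOn (iteratedDerivWithin k (p ∘ γ) (Icc 0 T)) (iteratedLieDeriv X p k ∘ γ) (Icc 0 T) := by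
  induction k with
  | zero => rw [iteratedDerivWithin_zero]; exact fun _ _ => rfl
  | succ k ih =>
    intro s hs
    rw [iteratedDerivWithin_succ, derivWithin_congr ih (ih hs)]
    have hd := ((contDiff_iteratedLieDeriv hX hp k).differentiable (by simp) (γ s)).hasFDerivAt
    exact (hd.comp_hasDerivWithinAt s (hγ s hs)).derivWithin (uniqueDiffOn_Icc hT s hs)

end LieDerivative

/-! ### Evaluation of configurations; smoothness of `hat` and `ad`. -/

section Curves

variable {l : ℝ}

lemma onLine_of_mem {V : Type*} [Zero V] (f : Icc (0 : ℝ) l → V) {s : ℝ} (hs : s ∈ Icc 0 l) :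
    onLine f s = f ⟨s, hs⟩ := dif_pos hs

lemma Config.curve_of_mem (c : Config l) {s : ℝ} (hs : s ∈ Icc 0 l) :
    c.curve s = (entries (c.g ⟨s, hs⟩), c.u ⟨s, hs⟩) := by
  rw [Config.curve, onLine_of_mem _ hs, onLine_of_mem _ hs]

/-- The component k = 0 of the smooth topology is uniform convergence of the curve itself. -/
lemma Config.continuous_curve_apply (s : Icc (0 : ℝ) l) :
    Continuous fun c : Config l => c.curve s := by
  have h : Continuous fun c : Config l => fun k => UniformFun.ofFun fun s : Icc (0 : ℝ) l =>
      iteratedDerivWithin k c.curve (Icc 0 l) s := continuous_induced_dom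
  have h0 := (UniformFun.uniformContinuous_eval (Arr × Vec6) s).continuous.comp
    ((continuous_apply 0).comp h)
  refine h0.congr fun c => ?_
  simp [Function.eval, iteratedDerivWithin_zero]

lemma contDiff_hat : ContDiff ℝ ∞ fun ξ : Vec6 => entries (hat ξ) := by
  refine contDiff_pi.2 fun i => contDiff_pi.2 fun j => ?_
  rcases i with i | i <;> rcases j with j | j
  · fin_cases i <;> fin_cases j <;> simp [entries, hat, hat3] <;> fun_prop
  · simp [entries, hat]; fun_prop
  · simp [entries, hat]; fun_prop
  · simp [entries, hat]; fun_prop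

lemma contDiff_ad (i j : Fin 3 ⊕ Fin 3) : ContDiff ℝ ∞ fun ξ : Vec6 => ad ξ i j := by
  rcases i with i | i <;> rcases j with j | j <;>
    fin_cases i <;> fin_cases j <;> simp [ad, hat3] <;> fun_prop

end Curves

/-! ### The shooting problem in terms of the flow. -/

namespace Robot

variable {n : ℕ} (r : Robot n)

/-- The diagonal of the stiffness matrix. -/
def stiffness : Fin 3 ⊕ Fin 3 → ℝ :=
  Sum.elim ![r.E * r.I, r.E * r.I, r.G * r.J] ![r.G * r.A, r.G * r.A, r.E * r.A]

lemma stiffness_ne_zero (i : Fin 3 ⊕ Fin 3) : r.stiffness i ≠ 0 := by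
  have := r.E_pos; have := r.I_pos; have := r.G_pos; have := r.J_pos; have := r.A_pos
  rcases i with i | i <;> fin_cases i <;> simp [stiffness] <;> constructor <;> positivity

lemma C_mulVec_apply (v : Vec6) (i : Fin 3 ⊕ Fin 3) : (r.C *ᵥ v) i = r.stiffness i * v i :=
  Matrix.mulVec_diagonal _ _ _

/-- The inverse of the stiffness matrix. -/
def compliance : Vec6 →L[ℝ] Vec6 :=
  ContinuousLinearMap.pi fun i => (r.stiffness i)⁻¹ • ContinuousLinearMap.proj i

lemma compliance_C_mulVec (v : Vec6) : r.compliance (r.C *ᵥ v) = v := by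
  ext i
  simp [compliance, C_mulVec_apply, r.stiffness_ne_zero i]

lemma C_mulVec_compliance (v : Vec6) : r.C *ᵥ r.compliance v = v := by
  ext i
  simp [compliance, C_mulVec_apply, r.stiffness_ne_zero i]

lemma contDiff_C_mulVec : ContDiff ℝ ∞ fun v : Vec6 => r.C *ᵥ v :=
  contDiff_pi.2 fun i => by simp only [C_mulVec_apply]; fun_prop

/-- A smooth extension of the distributed potential to all matrices. -/
def ambientU : Arr → ℝ := r.U_smooth.exists_contDiff.choose

lemma contDiff_ambientU : ContDiff ℝ ∞ r.ambientU := r.U_smooth.exists_contDiff.choose_spec.1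

lemma wrenchOf_U (g : SE3) : wrenchOf r.U g = ambientWrench r.ambientU (entries g) :=
  wrenchOf_eq_ambientWrench r.contDiff_ambientU r.U_smooth.exists_contDiff.choose_spec.2 g

/-- A smooth extension of the tip potential to all matrices. -/
def ambientUtip : Arr → ℝ := r.Utip_smooth.exists_contDiff.choose

lemma contDiff_ambientUtip : ContDiff ℝ ∞ r.ambientUtip :=
  r.Utip_smooth.exists_contDiff.choose_spec.1

lemma wrenchOf_Utip (g : SE3) : wrenchOf r.Utip g = ambientWrench r.ambientUtip (entries g) :=
  wrenchOf_eq_ambientWrench r.contDiff_ambientUtip r.Utip_smooth.exists_contDiff.choose_spec.2 g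

/-- The vector field of the canonical equations on the states `((g, u), τ)`. -/
def field (z : (Arr × Vec6) × Act n) : (Arr × Vec6) × Act n :=
  ((entries (Matrix.of z.1.1 * hat (r.ξ₀ + z.1.2)),
    r.compliance ((ad (r.ξ₀ + z.1.2))ᵀ *ᵥ (r.C *ᵥ z.1.2 + r.Λad z.2) -
      ambientWrench r.ambientU z.1.1)), 0)

lemma contDiff_field : ContDiff ℝ ∞ r.field := by
  have hξ : ContDiff ℝ ∞ fun z : (Arr × Vec6) × Act n => r.ξ₀ + z.1.2 := by fun_prop
  have hg : ContDiff ℝ ∞ fun z : (Arr × Vec6) × Act n => z.1.1 := by fun_prop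
  have hu : ContDiff ℝ ∞ fun z : (Arr × Vec6) × Act n => z.1.2 := by fun_prop
  refine (ContDiff.prodMk ?_ (r.compliance.contDiff.comp (ContDiff.sub ?_
    ((contDiff_ambientWrench r.contDiff_ambientU).comp hg)))).prodMk contDiff_const
  · refine contDiff_pi.2 fun i => contDiff_pi.2 fun j => ?_
    simp only [entries, Matrix.mul_apply, Matrix.of_apply]
    refine ContDiff.sum fun k _ => (contDiff_pi.1 (contDiff_pi.1 hg i) k).mul ?_
    exact contDiff_pi.1 (contDiff_pi.1 (contDiff_hat.comp hξ) k) j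
  · have hΛ : ContDiff ℝ ∞ fun z : (Arr × Vec6) × Act n => r.C *ᵥ z.1.2 + r.Λad z.2 :=
      (r.contDiff_C_mulVec.comp hu).add (r.Λad_smooth.comp contDiff_snd)
    refine contDiff_pi.2 fun i => ?_
    simp only [Matrix.mulVec, dotProduct, Matrix.transpose_apply]
    exact ContDiff.sum fun k _ => ((contDiff_ad k i).comp hξ).mul (contDiff_pi.1 hΛ k)

/-- The maximal domain of the flow of the canonical equations. -/
def flowDomain : Set (((Arr × Vec6) × Act n) × ℝ) :=
  (exists_smooth_flow r.contDiff_field).choose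

/-- The flow of the canonical equations. -/
def flow : ((Arr × Vec6) × Act n) × ℝ → (Arr × Vec6) × Act n :=
  (exists_smooth_flow r.contDiff_field).choose_spec.choose

lemma isOpen_flowDomain : IsOpen r.flowDomain :=
  (exists_smooth_flow r.contDiff_field).choose_spec.choose_spec.1

lemma contDiffOn_flow : ContDiffOn ℝ ∞ r.flow r.flowDomain :=
  (exists_smooth_flow r.contDiff_field).choose_spec.choose_spec.2.1

lemma isIntegralCurveOn_flow {z : (Arr × Vec6) × Act n} {T : ℝ} (hT : 0 < T)
    (h : (z, T) ∈ r.flowDomain) :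
    IsIntegralCurveOn (fun t => r.flow (z, t)) (fun _ => r.field) (Icc 0 T) ∧
      r.flow (z, 0) = z :=
  (exists_smooth_flow r.contDiff_field).choose_spec.choose_spec.2.2.1 z T hT h

lemma flow_eq_of_isIntegralCurveOn {T : ℝ} {γ : ℝ → (Arr × Vec6) × Act n}
    (hγ : IsIntegralCurveOn γ (fun _ => r.field) (Icc 0 T)) {t : ℝ} (ht : t ∈ Icc 0 T) :
    (γ 0, t) ∈ r.flowDomain ∧ r.flow (γ 0, t) = γ t :=
  (exists_smooth_flow r.contDiff_field).choose_spec.choose_spec.2.2.2 T γ hγ t ht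

lemma mem_flowDomain_of_mem_Icc {z : (Arr × Vec6) × Act n} (h : (z, r.l) ∈ r.flowDomain) {t : ℝ}
    (ht : t ∈ Icc 0 r.l) : (z, t) ∈ r.flowDomain := by
  obtain ⟨h1, h2⟩ := r.isIntegralCurveOn_flow r.l_pos h
  simpa only [h2] using (r.flow_eq_of_isIntegralCurveOn h1 ht).1

/-- The initial state of the shooting problem with data `(λ, τ)`. -/
def initial (x : Vec6 × Act n) : (Arr × Vec6) × Act n := ((entries 1, r.compliance x.1), x.2)

lemma contDiff_initial : ContDiff ℝ ∞ r.initial :=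
  (contDiff_const.prodMk (r.compliance.contDiff.comp contDiff_fst)).prodMk contDiff_snd

lemma zero_mem_Icc : (0 : ℝ) ∈ Icc 0 r.l := left_mem_Icc.2 r.l_pos.le

lemma l_mem_Icc : r.l ∈ Icc 0 r.l := right_mem_Icc.2 r.l_pos.le

variable {r}

lemma Shoots.isIntegralCurveOn {x : Vec6 × Act n} {c : Config r.l} (h : r.Shoots x c) :
    IsIntegralCurveOn (fun s => (c.curve s, x.2)) (fun _ => r.field) (Icc 0 r.l) := by
  intro s hs
  refine HasDerivWithinAt.prodMk (HasDerivWithinAt.prodMk ?_ ?_) (hasDerivWithinAt_const _ _ _)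
  · have := h.1.deriv_g ⟨s, hs⟩
    refine this.congr_deriv ?_
    change _ = entries (Matrix.of (c.curve s).1 * hat (r.ξ₀ + (c.curve s).2))
    rw [c.curve_of_mem hs]
    rfl
  · have hΛ := (r.compliance.hasFDerivAt.comp_hasDerivWithinAt s
      ((h.1.deriv_Λ ⟨s, hs⟩).sub_const (r.Λad x.2)))
    have hu : ∀ t ∈ Icc 0 r.l, onLine c.u t =
        r.compliance (onLine (r.Λ x.2 c) t - r.Λad x.2) := fun t ht => by
      rw [onLine_of_mem _ ht, onLine_of_mem _ ht, Λ, add_sub_cancel_right, compliance_C_mulVec]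
    refine (hΛ.congr hu (hu s hs)).congr_deriv ?_
    beta_reduce
    rw [c.curve_of_mem hs, wrenchOf_U]
    rfl

lemma Shoots.curve_zero {x : Vec6 × Act n} {c : Config r.l} (h : r.Shoots x c) :
    (c.curve 0, x.2) = r.initial x := by
  have h1 : (c.g ⟨0, r.zero_mem_Icc⟩ : Mat4) = 1 := h.1.start
  have h2 : r.C *ᵥ c.u ⟨0, r.zero_mem_Icc⟩ = x.1 := h.2
  rw [c.curve_of_mem r.zero_mem_Icc, initial, h1, ← h2, compliance_C_mulVec]

lemma Shoots.flow_eq {x : Vec6 × Act n} {c : Config r.l} (h : r.Shoots x c) {s : ℝ}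
    (hs : s ∈ Icc 0 r.l) :
    (r.initial x, s) ∈ r.flowDomain ∧ r.flow (r.initial x, s) = (c.curve s, x.2) := by
  have := r.flow_eq_of_isIntegralCurveOn h.isIntegralCurveOn hs
  rwa [h.curve_zero] at this

variable (r)

/-- The flow lives on all matrices, but its integral curve from the identity keeps τ fixed and stays
in `SE3`, so it defines a configuration. -/
lemma exists_shoots {x : Vec6 × Act n} (h : (r.initial x, r.l) ∈ r.flowDomain) :
    ∃ c, r.Shoots x c := by
  obtain ⟨hγ, hγ0⟩ := r.isIntegralCurveOn_flow r.l_pos h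
  set γ : ℝ → (Arr × Vec6) × Act n := fun t => r.flow (r.initial x, t)
  have hγ0 : γ 0 = r.initial x := hγ0
  have hsmooth : ContDiffOn ℝ ∞ γ (Icc 0 r.l) :=
    r.contDiffOn_flow.comp (contDiff_const.prodMk contDiff_id).contDiffOn
      fun t ht => r.mem_flowDomain_of_mem_Icc h ht
  have hdfst : ∀ s ∈ Icc 0 r.l, HasDerivWithinAt (fun s => (γ s).1) (r.field (γ s)).1
      (Icc 0 r.l) s := fun s hs =>
    (ContinuousLinearMap.fst ℝ (Arr × Vec6) (Act n)).hasFDerivAt.comp_hasDerivWithinAt s (hγ s hs)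
  have hdg : ∀ s ∈ Icc 0 r.l, HasDerivWithinAt (fun s => (γ s).1.1) (r.field (γ s)).1.1
      (Icc 0 r.l) s := fun s hs =>
    (ContinuousLinearMap.fst ℝ Arr Vec6).hasFDerivAt.comp_hasDerivWithinAt s (hdfst s hs)
  have hdu : ∀ s ∈ Icc 0 r.l, HasDerivWithinAt (fun s => (γ s).1.2) (r.field (γ s)).1.2
      (Icc 0 r.l) s := fun s hs =>
    (ContinuousLinearMap.snd ℝ Arr Vec6).hasFDerivAt.comp_hasDerivWithinAt s (hdfst s hs)
  have hτ : ∀ s ∈ Icc 0 r.l, (γ s).2 = x.2 := by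
    intro s hs
    have hd : ∀ s ∈ Icc 0 r.l, HasDerivWithinAt (fun s => (γ s).2) 0 (Icc 0 r.l) s := fun s hs =>
      (ContinuousLinearMap.snd ℝ (Arr × Vec6) (Act n)).hasFDerivAt.comp_hasDerivWithinAt s (hγ s hs)
    rw [eq_of_hasDerivWithinAt_zero hd s hs, hγ0]
    rfl
  have hmem : ∀ s ∈ Icc 0 r.l, Matrix.of (γ s).1.1 ∈ SE3 :=
    mem_SE3_of_hasDerivWithinAt (ξ := fun s => r.ξ₀ + (γ s).1.2)
      (by rw [hγ0]; rfl) fun s hs => hdg s hs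
  have hg : ∀ s ∈ Icc 0 r.l, onLine (fun s : Icc 0 r.l =>
      entries ((⟨Matrix.of (γ s).1.1, hmem s s.2⟩ : SE3) : Mat4)) s = (γ s).1.1 :=
    fun s hs => onLine_of_mem _ hs
  have hu : ∀ s ∈ Icc 0 r.l, onLine (fun s : Icc 0 r.l => (γ s).1.2) s = (γ s).1.2 :=
    fun s hs => onLine_of_mem _ hs
  let c : Config r.l :=
    { g := fun s => ⟨Matrix.of (γ s).1.1, hmem s s.2⟩
      u := fun s => (γ s).1.2
      smooth_g := (contDiff_fst.fst.comp_contDiffOn hsmooth).congr hg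
      smooth_u := (contDiff_fst.snd.comp_contDiffOn hsmooth).congr hu }
  refine ⟨c, ⟨?_, fun s => ?_, fun s => ?_⟩, ?_⟩
  · change Matrix.of (γ 0).1.1 = 1
    rw [hγ0]
    rfl
  · exact (hdg s s.2).congr hg (hg s s.2)
  · have hΛ : ∀ t ∈ Icc 0 r.l, onLine (r.Λ x.2 c) t = r.C *ᵥ (γ t).1.2 + r.Λad x.2 :=
      fun t ht => onLine_of_mem _ ht
    let L : Vec6 →L[ℝ] Vec6 := LinearMap.toContinuousLinearMap (Matrix.mulVecLin r.C)
    have hd : HasDerivWithinAt (fun t => r.C *ᵥ (γ t).1.2 + r.Λad x.2)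
        (r.C *ᵥ (r.field (γ s)).1.2) (Icc 0 r.l) s :=
      (L.hasFDerivAt.comp_hasDerivWithinAt (s : ℝ) (hdu s s.2)).add_const _
    refine (hd.congr hΛ (hΛ s s.2)).congr_deriv ?_
    rw [field, C_mulVec_compliance, wrenchOf_U, hτ s s.2]
    rfl
  · change r.C *ᵥ (γ 0).1.2 = x.1
    rw [hγ0]
    exact r.C_mulVec_compliance _

lemma mem_shootingDomain_iff {x : Vec6 × Act n} :
    x ∈ r.shootingDomain ↔ (r.initial x, r.l) ∈ r.flowDomain :=
  ⟨fun ⟨_, hc⟩ => (hc.flow_eq r.l_mem_Icc).1, fun h => r.exists_shoots h⟩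

lemma isOpen_shootingDomain : IsOpen r.shootingDomain := by
  have : r.shootingDomain = (fun x => (r.initial x, r.l)) ⁻¹' r.flowDomain :=
    Set.ext fun _ => r.mem_shootingDomain_iff
  rw [this]
  exact r.isOpen_flowDomain.preimage (r.contDiff_initial.continuous.prodMk continuous_const)

variable {r}

lemma shoots_Ψ {x : Vec6 × Act n} (h : x ∈ r.shootingDomain) : r.Shoots x (r.Ψ x) :=
  Classical.epsilon_spec h

lemma curve_Ψ {x : Vec6 × Act n} (h : x ∈ r.shootingDomain) {s : ℝ} (hs : s ∈ Icc 0 r.l) :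
    (r.Ψ x).curve s = (r.flow (r.initial x, s)).1 := by
  rw [((shoots_Ψ h).flow_eq hs).2]

lemma initial_mem_flowDomain {x : Vec6 × Act n} (h : x ∈ r.shootingDomain) {s : ℝ}
    (hs : s ∈ Icc 0 r.l) : (r.initial x, s) ∈ r.flowDomain :=
  ((shoots_Ψ h).flow_eq hs).1

variable (r)

/-- The defect of the tip condition in terms of the flow. -/
def tipDefect (x : Vec6 × Act n) : Vec6 :=
  r.C *ᵥ (r.flow (r.initial x, r.l)).1.2 + r.Λad x.2 -
    ambientWrench r.ambientUtip (r.flow (r.initial x, r.l)).1.1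

lemma F_eq_tipDefect : EqOn r.F r.tipDefect r.shootingDomain := by
  intro x hx
  rw [tipDefect, ← curve_Ψ hx r.l_mem_Icc, Config.curve_of_mem _ r.l_mem_Icc, F, wrenchOf_Utip]
  rfl

lemma contDiffOn_F : ContDiffOn ℝ ∞ r.F r.shootingDomain := by
  refine ContDiffOn.congr ?_ r.F_eq_tipDefect
  have hflow : ContDiffOn ℝ ∞ (fun x => r.flow (r.initial x, r.l)) r.shootingDomain :=
    r.contDiffOn_flow.comp (r.contDiff_initial.prodMk contDiff_const).contDiffOn
      fun x hx => r.mem_shootingDomain_iff.1 hx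
  exact ((r.contDiff_C_mulVec.comp_contDiffOn hflow.fst.snd).add
    (r.Λad_smooth.comp contDiff_snd).contDiffOn).sub
    ((contDiff_ambientWrench r.contDiff_ambientUtip).comp_contDiffOn hflow.fst.fst)

/-- The shooting map is continuous into the smooth topology. -/
lemma continuousOn_Ψ : ContinuousOn r.Ψ r.shootingDomain := by
  rw [continuousOn_iff_continuous_domRestrict]
  refine continuous_induced_rng.2 (continuous_pi fun k => ?_)
  -- The k-th derivative is jointly continuous in (x, s). Currying makes it continuous in x for the
  -- compact-open topology, which on [0, l] is uniform convergence.
  let q : C(r.shootingDomain × Icc 0 r.l, Arr × Vec6) :=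
    ⟨fun p => iteratedLieDeriv r.field Prod.fst k (r.flow (r.initial p.1, p.2)), by
      refine (contDiff_iteratedLieDeriv r.contDiff_field contDiff_fst k).continuous.comp ?_
      refine r.contDiffOn_flow.continuousOn.comp_continuous ?_ fun p =>
        initial_mem_flowDomain p.1.2 p.2.2
      exact (r.contDiff_initial.continuous.comp (continuous_subtype_val.comp continuous_fst)).prodMk
        (continuous_subtype_val.comp continuous_snd)⟩
  have hq : ∀ (x : r.shootingDomain) (s : Icc 0 r.l),
      iteratedDerivWithin k (r.Ψ x).curve (Icc 0 r.l) s = q (x, s) := by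
    intro x s
    have hint := (r.isIntegralCurveOn_flow r.l_pos (r.mem_shootingDomain_iff.1 x.2)).1
    rw [iteratedDerivWithin_congr (fun t ht => curve_Ψ x.2 ht) s.2]
    exact iteratedDerivWithin_comp_integralCurve r.contDiff_field contDiff_fst r.l_pos hint k s.2
  refine continuous_iff_continuousAt.2 fun x => ?_
  refine UniformFun.tendsto_iff_tendstoUniformly.2 ?_
  have hcurry := ContinuousMap.tendsto_iff_tendstoUniformly.1 (q.curry.continuous.tendsto x)
  convert hcurry using 1
  · funext y s
    exact hq y s
  · funext s
    exact hq x s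

/-- The continuous map `G` reads off C u(0) and W₊(g(l)) - C u(l). On solutions of the tip condition
these are λ and Λ_ad(τ), so G ∘ Ψ is an embedding and hence so is Ψ. -/
lemma isEmbedding_Ψ (hτ : IsEmbedding r.Λad) :
    IsEmbedding fun x : r.admissible => r.Ψ x := by
  let G : Config r.l → Vec6 × Vec6 := fun c =>
    (r.C *ᵥ (c.curve r.base).2,
      ambientWrench r.ambientUtip (c.curve r.tip).1 - r.C *ᵥ (c.curve r.tip).2)
  have hG : Continuous G := by
    have hC := r.contDiff_C_mulVec.continuous
    have hl := Config.continuous_curve_apply r.tip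
    exact (hC.comp (continuous_snd.comp (Config.continuous_curve_apply r.base))).prodMk
      (((contDiff_ambientWrench r.contDiff_ambientUtip).continuous.comp
        (continuous_fst.comp hl)).sub (hC.comp (continuous_snd.comp hl)))
  have hΨ : Continuous fun x : r.admissible => r.Ψ x :=
    r.continuousOn_Ψ.comp_continuous continuous_subtype_val fun x => x.2.1
  refine IsEmbedding.of_comp hΨ hG ?_
  have hcomp : (G ∘ fun x : r.admissible => r.Ψ x) = Prod.map id r.Λad ∘ Subtype.val := by
    funext x
    refine Prod.ext ?_ ?_
    · change r.C *ᵥ ((r.Ψ x).curve r.base).2 = _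
      rw [Config.curve_of_mem _ r.base.2]
      exact (shoots_Ψ x.2.1).2
    · have h := x.2.2
      change ambientWrench r.ambientUtip ((r.Ψ x).curve r.tip).1 -
        r.C *ᵥ ((r.Ψ x).curve r.tip).2 = _
      rw [Config.curve_of_mem _ r.tip.2, ← wrenchOf_Utip]
      rw [F, sub_eq_zero] at h
      rw [← h]
      exact add_sub_cancel_left _ _
  rw [hcomp]
  exact (IsEmbedding.id.prodMap hτ).comp IsEmbedding.subtypeVal

end Robot

/-! ### Regular zero sets as local graphs. -/

section LocalGraph

variable {V P : Type*} [NormedAddCommGroup V] [NormedSpace ℝ V] [NormedAddCommGroup P]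
  [NormedSpace ℝ P]

/-- A subset of `V × P` that near each of its points is the graph of a smooth function from an
open subset of `P` to `V`. -/
def IsLocallySmoothGraph (R : Set (V × P)) : Prop :=
  ∀ x ∈ R, ∃ (W : Set P) (φ : P → V) (N : Set (V × P)), IsOpen W ∧ IsOpen N ∧
    ContDiffOn ℝ ∞ φ W ∧ x ∈ N ∧ (∀ y ∈ N, y.2 ∈ W) ∧ (∀ y ∈ N, y ∈ R ↔ y.1 = φ y.2) ∧
    ∀ τ ∈ W, (φ τ, τ) ∈ N

variable [CompleteSpace V] [CompleteSpace P] {f : V × P → V} {D : Set (V × P)}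

/-- The swap of factors is needed because the equation is solved here for the first variable,
whereas the implicit function theorem used solves for the second. -/
lemma exists_implicit_function (hD : IsOpen D) (hf : ContDiffOn ℝ ∞ f D) {x : V × P} (hx : x ∈ D)
    (hx0 : f x = 0) (hinv : (fderiv ℝ f x ∘L .inl ℝ V P).IsInvertible) :
    ∃ φ : P → V, ContDiffAt ℝ ∞ φ x.2 ∧ φ x.2 = x.1 ∧ ∀ᶠ y in 𝓝 x, f y = 0 ↔ y.1 = φ y.2 := by
  have hn : (∞ : WithTop ℕ∞) ≠ 0 := by simp
  have hfx : ContDiffAt ℝ ∞ f x := hf.contDiffAt (hD.mem_nhds hx)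
  have hswap : HasFDerivAt (Prod.swap : P × V → V × P)
      (ContinuousLinearEquiv.prodComm ℝ P V : P × V →L[ℝ] V × P) x.swap :=
    (ContinuousLinearEquiv.prodComm ℝ P V).hasFDerivAt
  have hc : ContDiffAt ℝ ∞ (f ∘ Prod.swap) (x.swap) :=
    ContDiffAt.comp (x.swap) (by rwa [Prod.swap_swap])
      (ContinuousLinearEquiv.prodComm ℝ P V).contDiff.contDiffAt
  have hd : fderiv ℝ (f ∘ Prod.swap) x.swap ∘L .inr ℝ P V = fderiv ℝ f x ∘L .inl ℝ V P := by
    have h1 : HasFDerivAt f (fderiv ℝ f x) (x.swap.swap) := by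
      rw [Prod.swap_swap]; exact (hfx.differentiableAt hn).hasFDerivAt
    rw [(h1.comp x.swap hswap).fderiv]
    ext v
    rfl
  have hinv' : (fderiv ℝ (f ∘ Prod.swap) x.swap ∘L .inr ℝ P V).IsInvertible := by rwa [hd]
  refine ⟨hc.implicitFunction hn hinv', hc.contDiffAt_implicitFunction hn hinv',
    hc.implicitFunction_apply_self hn hinv', ?_⟩
  have h := hc.eventually_apply_eq_iff_implicitFunction hn hinv'
  have hcont : ContinuousAt (Prod.swap : V × P → P × V) x := continuous_swap.continuousAt
  filter_upwards [hcont.eventually h] with y hy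
  simp only [Function.comp_apply, Prod.swap_swap, hx0, Prod.fst_swap, Prod.snd_swap] at hy
  rw [hy, eq_comm]

lemma isLocallySmoothGraph_zeroSet (hD : IsOpen D) (hf : ContDiffOn ℝ ∞ f D) :
    IsLocallySmoothGraph
      {x | x ∈ D ∧ f x = 0 ∧ (fderiv ℝ f x ∘L .inl ℝ V P).IsInvertible} := by
  rintro x ⟨hxD, hx0, hxinv⟩
  obtain ⟨φ, hφ, hφx, hφiff⟩ := exists_implicit_function hD hf hxD hx0 hxinv
  have hopen : ∀ᶠ y in 𝓝 x, (fderiv ℝ f y ∘L .inl ℝ V P).IsInvertible := by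
    have hc : ContinuousAt (fun y => fderiv ℝ f y ∘L .inl ℝ V P) x :=
      ((hf.continuousOn_fderiv_of_isOpen hD (by simp)).continuousAt (hD.mem_nhds hxD)).clm_comp
        continuousAt_const
    exact hc.eventually (ContinuousLinearEquiv.isOpen.mem_nhds hxinv)
  obtain ⟨N, hN, hNo, hxN⟩ := eventually_nhds_iff.1
    ((hφiff.and (hD.mem_nhds hxD)).and hopen)
  -- Smoothness of order ∞ at one point does not spread to a neighbourhood; C¹ does, and suffices
  -- for continuity of φ.
  obtain ⟨W, hW, hWo, hxW⟩ := eventually_nhds_iff.1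
    ((hφ.of_le (m := 1) (by exact_mod_cast le_top)).eventually (by simp))
  have hcont : ContinuousOn (fun τ => (φ τ, τ)) W := fun τ hτ =>
    ((hW τ hτ).continuousAt.prodMk continuousAt_id).continuousWithinAt
  have hWN : IsOpen (W ∩ (fun τ => (φ τ, τ)) ⁻¹' N) := hcont.isOpen_inter_preimage hWo hNo
  refine ⟨_, φ, N ∩ Prod.snd ⁻¹' (W ∩ (fun τ => (φ τ, τ)) ⁻¹' N), hWN,
    hNo.inter (hWN.preimage continuous_snd), ?_, ⟨hxN, hxW, ?_⟩, fun y hy => hy.2, ?_,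
    fun τ hτ => ⟨hτ.2, hτ⟩⟩
  · intro τ hτ
    have hy := hN _ hτ.2
    -- To get order ∞ on all of the domain, the equation is solved afresh at each nearby point; the
    -- new solution ψ agrees with φ because both describe the same zero set.
    obtain ⟨ψ, hψ, -, hψiff⟩ := exists_implicit_function hD hf hy.1.2 (hy.1.1.2 rfl) hy.2
    refine (hψ.congr_of_eventuallyEq ?_).contDiffWithinAt
    have hct : ContinuousAt (fun τ => (φ τ, τ)) τ := hcont.continuousAt (hWo.mem_nhds hτ.1)
    filter_upwards [hct.eventually hψiff, hWN.mem_nhds hτ] with σ hσ hσW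
    exact hσ.1 ((hN _ hσW.2).1.1.2 rfl)
  · change (φ x.2, x.2) ∈ N
    rwa [hφx]
  · intro y hy
    have h := hN y hy.1
    exact ⟨fun hyR => h.1.1.1 hyR.2.1, fun hyφ => ⟨h.1.2, h.1.1.2 hyφ, h.2⟩⟩

end LocalGraph

/-! ### Manifold structure on an embedded local graph. -/

section Manifold

variable {V P M : Type} [NormedAddCommGroup V] [NormedSpace ℝ V] [NormedAddCommGroup P]
  [NormedSpace ℝ P] [TopologicalSpace M] {ι : M → V × P}

lemma exists_graphChart (hι : IsEmbedding ι) (hR : IsLocallySmoothGraph (range ι)) (m : M) :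
    ∃ (e : OpenPartialHomeomorph M P) (φ : P → V), m ∈ e.source ∧ ContDiffOn ℝ ∞ φ e.target ∧
      (∀ p, e p = (ι p).2) ∧ ∀ τ ∈ e.target, ι (e.symm τ) = (φ τ, τ) := by
  obtain ⟨W, φ, N, hW, hN, hφ, hmN, hNW, hNR, hWN⟩ := hR _ (mem_range_self m)
  have : Nonempty M := ⟨m⟩
  have hinv : ∀ τ ∈ W, ι (Function.invFun ι (φ τ, τ)) = (φ τ, τ) := fun τ hτ =>
    Function.invFun_eq ((hNR _ (hWN τ hτ)).2 rfl)
  refine ⟨{ toFun := fun p => (ι p).2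
            invFun := fun τ => Function.invFun ι (φ τ, τ)
            source := ι ⁻¹' N
            target := W
            map_source' := fun p hp => hNW _ hp
            map_target' := fun τ hτ => by rw [mem_preimage, hinv τ hτ]; exact hWN τ hτ
            left_inv' := fun p hp => hι.injective (by
              rw [hinv _ (hNW _ hp)]
              exact Prod.ext ((hNR _ hp).1 (mem_range_self p)).symm rfl)
            right_inv' := fun τ hτ => by rw [hinv τ hτ]
            open_source := hN.preimage hι.continuous
            open_target := hW
            continuousOn_toFun := (continuous_snd.comp hι.continuous).continuousOn
            continuousOn_invFun := by
              rw [hι.isInducing.continuousOn_iff]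
              exact (hφ.continuousOn.prodMk continuousOn_id).congr hinv },
    φ, hmN, hφ, fun _ => rfl, hinv⟩

/-- The diffeomorphism `(v, τ) ↦ (v - φ(τ), τ)` over the domain of `φ`. -/
def straighten {φ : P → V} {W : Set P} (hW : IsOpen W) (hφ : ContinuousOn φ W) :
    OpenPartialHomeomorph (V × P) (V × P) where
  toFun y := (y.1 - φ y.2, y.2)
  invFun y := (y.1 + φ y.2, y.2)
  source := Prod.snd ⁻¹' W
  target := Prod.snd ⁻¹' W
  map_source' _ h := h
  map_target' _ h := h
  left_inv' y _ := by simp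
  right_inv' y _ := by simp
  open_source := hW.preimage continuous_snd
  open_target := hW.preimage continuous_snd
  continuousOn_toFun := (continuousOn_fst.sub
    (hφ.comp continuousOn_snd fun _ h => h)).prodMk continuousOn_snd
  continuousOn_invFun := (continuousOn_fst.add
    (hφ.comp continuousOn_snd fun _ h => h)).prodMk continuousOn_snd

lemma straighten_mem_maximalAtlas {φ : P → V} {W : Set P} (hW : IsOpen W)
    (hφ : ContDiffOn ℝ ∞ φ W) :
    straighten hW hφ.continuousOn ∈ IsManifold.maximalAtlas 𝓘(ℝ, V × P) ∞ (V × P) := by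
  refine StructureGroupoid.mem_maximalAtlas_of_mem_groupoid _ ?_
  rw [contDiffGroupoid, mem_groupoid_of_pregroupoid]
  have hφ2 : ContDiffOn ℝ ∞ (fun y : V × P => φ y.2) (Prod.snd ⁻¹' W) :=
    hφ.comp contDiff_snd.contDiffOn fun _ h => h
  constructor
  · exact ((contDiff_fst.contDiffOn.sub hφ2).prodMk contDiff_snd.contDiffOn).mono fun y hy => hy.1
  · exact ((contDiff_fst.contDiffOn.add hφ2).prodMk contDiff_snd.contDiffOn).mono fun y hy => hy.1

/-- A topologically embedded space that is locally a smooth graph over `P` is a smoothly embedded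
manifold modelled on `P`. -/
theorem exists_chartedSpace_isSmoothEmbedding (hι : IsEmbedding ι)
    (hR : IsLocallySmoothGraph (range ι)) :
    ∃ _ : ChartedSpace P M, IsManifold 𝓘(ℝ, P) ∞ M ∧
      Manifold.IsSmoothEmbedding 𝓘(ℝ, P) 𝓘(ℝ, V × P) ∞ ι := by
  choose e φ hmem hφ he hsymm using exists_graphChart hι hR
  let cs : ChartedSpace P M :=
    { atlas := range e
      chartAt := e
      mem_chart_source := hmem
      chart_mem_atlas := fun m => mem_range_self m }
  have hman : IsManifold 𝓘(ℝ, P) ∞ M := by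
    refine isManifold_of_contDiffOn _ _ _ ?_
    rintro _ _ ⟨a, rfl⟩ ⟨b, rfl⟩
    -- All charts are the projection to τ, so every transition map is the identity.
    refine contDiffOn_id.congr fun τ hτ => ?_
    have hτa : τ ∈ (e a).target := hτ.1.1
    change e b ((e a).symm τ) = τ
    rw [he, hsymm a τ hτa]
  suffices himm : Manifold.IsImmersionOfComplement V 𝓘(ℝ, P) 𝓘(ℝ, V × P) ∞ ι by
    exact ⟨cs, hman, himm.isImmersion, hι⟩
  intro m
  -- After straightening the graph, ι reads τ ↦ (0, τ), with `V` as complement.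
  refine Manifold.IsImmersionAtOfComplement.mk_of_continuousAt hι.continuous.continuousAt
    (ContinuousLinearEquiv.prodComm ℝ P V) (e m) (straighten (e m).open_target (hφ m).continuousOn)
    (hmem m) ?_ (IsManifold.subset_maximalAtlas (mem_range_self m))
    (straighten_mem_maximalAtlas _ (hφ m)) ?_
  · change (ι m).2 ∈ (e m).target
    rw [← he m]
    exact (e m).map_source (hmem m)
  · intro τ hτ
    have hτ' : τ ∈ (e m).target := by simpa using hτ
    change straighten (e m).open_target (hφ m).continuousOn (ι ((e m).symm τ)) = _
    rw [hsymm m τ hτ']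
    change (φ m τ - φ m τ, τ) = (0, τ)
    rw [sub_self]

end Manifold

/-! ### The regular set and its image under `Ψ`. -/

namespace Robot

variable {n : ℕ} (r : Robot n)

lemma finrank_range_eq_six_iff (L : Vec6 →L[ℝ] Vec6) :
    Module.finrank ℝ (LinearMap.range L.toLinearMap) = 6 ↔ L.IsInvertible := by
  have h6 : Module.finrank ℝ Vec6 = 6 := by simp
  constructor
  · intro h
    have hsurj : Function.Surjective L.toLinearMap :=
      LinearMap.range_eq_top.1 (Submodule.eq_top_of_finrank_eq (h.trans h6.symm))
    have hinj : Function.Injective L.toLinearMap := LinearMap.injective_iff_surjective.2 hsurj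
    exact ⟨(LinearEquiv.ofBijective L.toLinearMap ⟨hinj, hsurj⟩).toContinuousLinearEquiv, by
      ext; rfl⟩
  · intro h
    rw [LinearMap.range_eq_top.2 (show Function.Surjective L.toLinearMap from h.surjective),
      finrank_top, h6]

/-- On the open shooting domain the derivative in λ is the full derivative restricted to the first
factor, and rank 6 on a six-dimensional space means invertible. -/
lemma regular_eq : r.regular = {x | x ∈ r.shootingDomain ∧ r.F x = 0 ∧
    (fderiv ℝ r.F x ∘L .inl ℝ Vec6 (Act n)).IsInvertible} := by
  have key : ∀ x ∈ r.shootingDomain, fderiv ℝ (fun lam => r.F (lam, x.2)) x.1 =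
      fderiv ℝ r.F x ∘L .inl ℝ Vec6 (Act n) := by
    intro x hx
    have hd : HasFDerivAt r.F (fderiv ℝ r.F x) (x.1, x.2) :=
      ((r.contDiffOn_F.contDiffAt (r.isOpen_shootingDomain.mem_nhds hx)).differentiableAt
        (by simp)).hasFDerivAt
    exact (HasFDerivAt.comp (f := fun lam => (lam, x.2)) x.1 hd
      (hasFDerivAt_prodMk_left x.1 x.2)).fderiv
  ext x
  constructor
  · rintro ⟨⟨hx, hx0⟩, hrank⟩
    rw [key x hx, finrank_range_eq_six_iff] at hrank
    exact ⟨hx, hx0, hrank⟩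
  · rintro ⟨hx, hx0, hinv⟩
    refine ⟨⟨hx, hx0⟩, ?_⟩
    rwa [key x hx, finrank_range_eq_six_iff]

/-- The shooting map as a homeomorphism from the regular set onto its image. -/
lemma exists_homeomorph_regular (hτ : IsEmbedding r.Λad) :
    ∃ e : r.regular ≃ₜ r.Ψ '' r.regular, ∀ x, (e x : Config r.l) = r.Ψ x := by
  let f : r.regular → r.Ψ '' r.regular := fun x => ⟨r.Ψ x, mem_image_of_mem _ x.2⟩
  have hΨ : IsEmbedding fun x : r.regular => r.Ψ x :=
    (r.isEmbedding_Ψ hτ).comp (IsEmbedding.inclusion fun _ hx => hx.1)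
  have hf : IsEmbedding f := hΨ.codRestrict _ fun x => mem_image_of_mem _ x.2
  refine ⟨hf.toHomeomorphOfSurjective ?_, fun x => rfl⟩
  rintro ⟨_, x, hx, rfl⟩
  exact ⟨⟨x, hx⟩, rfl⟩

lemma image_regular_subset_configSet : r.Ψ '' r.regular ⊆ r.configSet := by
  rintro _ ⟨x, hx, rfl⟩
  exact ⟨x.2, (shoots_Ψ hx.1.1).1, hx.1.2⟩

end Robot

end ContinuumRobot

end

theorem theorem1 {n : ℕ} (r : ContinuumRobot.Robot n) (hτ : IsEmbedding r.Λad) :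
    r.Ψ '' r.regular ⊆ r.configSet ∧
    T2Space (r.Ψ '' r.regular) ∧ SecondCountableTopology (r.Ψ '' r.regular) ∧
    ∃ _ : ChartedSpace (EuclideanSpace ℝ (Fin n)) (r.Ψ '' r.regular),
      IsManifold (𝓡 n) ∞ (r.Ψ '' r.regular) ∧
      -- the inclusion into `C^∞([0, l], SE(3) × ℝ⁶)` is smooth: `(g, u)(s)` is jointly smooth
      ContMDiffOn ((𝓡 n).prod 𝓘(ℝ, ℝ)) 𝓘(ℝ, ContinuumRobot.Arr × ContinuumRobot.Vec6) ∞
        (fun p : (r.Ψ '' r.regular) × ℝ => p.1.1.curve p.2) (univ ×ˢ Icc 0 r.l) ∧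
      -- the inverse of `Ψ` on the regular set is a smooth embedding onto it
      ∃ Φ : (r.Ψ '' r.regular) → ContinuumRobot.Vec6 × ContinuumRobot.Act n,
        Manifold.IsSmoothEmbedding (𝓡 n) 𝓘(ℝ, ContinuumRobot.Vec6 × ContinuumRobot.Act n) ∞ Φ ∧
        range Φ = r.regular ∧ ∀ c, r.Ψ (Φ c) = c := by
  obtain ⟨e, he⟩ := r.exists_homeomorph_regular hτ
  let Φ : r.Ψ '' r.regular → ContinuumRobot.Vec6 × ContinuumRobot.Act n := fun c => e.symm c
  have hΦ : IsEmbedding Φ := IsEmbedding.subtypeVal.comp e.symm.isEmbedding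
  have hrange : range Φ = r.regular := by
    rw [show Φ = Subtype.val ∘ e.symm from rfl, e.symm.surjective.range_comp, Subtype.range_coe]
  have hΨΦ : ∀ c, r.Ψ (Φ c) = c := fun c => by
    rw [← he, e.apply_symm_apply]
  have hgraph : ContinuumRobot.IsLocallySmoothGraph (range Φ) := by
    rw [hrange, r.regular_eq]
    exact ContinuumRobot.isLocallySmoothGraph_zeroSet r.isOpen_shootingDomain r.contDiffOn_F
  obtain ⟨cs, hman, hemb⟩ := ContinuumRobot.exists_chartedSpace_isSmoothEmbedding hΦ hgraph
  refine ⟨r.image_regular_subset_configSet, hΦ.t2Space, hΦ.secondCountableTopology, cs, hman, ?_,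
    Φ, hemb, hrange, hΨΦ⟩
  -- Joint smoothness is inherited from the flow: (g, u)(s) is the state at time s started from `Φ
  -- (g, u)`.
  have hflow : ContMDiffOn (𝓘(ℝ, (ContinuumRobot.Vec6 × ContinuumRobot.Act n) × ℝ))
      𝓘(ℝ, ContinuumRobot.Arr × ContinuumRobot.Vec6) ∞
      (fun q : (ContinuumRobot.Vec6 × ContinuumRobot.Act n) × ℝ => (r.flow (r.initial q.1, q.2)).1)
      ((fun q => (r.initial q.1, q.2)) ⁻¹' r.flowDomain) :=
    (contDiff_fst.comp_contDiffOn (r.contDiffOn_flow.comp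
      ((r.contDiff_initial.comp contDiff_fst).prodMk contDiff_snd).contDiffOn
      fun q hq => hq)).contMDiffOn
  have hpair : ContMDiff ((𝓡 n).prod 𝓘(ℝ, ℝ))
      𝓘(ℝ, (ContinuumRobot.Vec6 × ContinuumRobot.Act n) × ℝ) ∞
      (fun p : (r.Ψ '' r.regular) × ℝ => (Φ p.1, p.2)) :=
    (hemb.contMDiff.comp contMDiff_fst).prodMk_space contMDiff_snd
  have hdom : ∀ c, Φ c ∈ r.shootingDomain := fun c =>
    (hrange ▸ mem_range_self c : Φ c ∈ r.regular).1.1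
  refine (hflow.comp hpair.contMDiffOn fun p hp =>
    ContinuumRobot.Robot.initial_mem_flowDomain (hdom p.1) hp.2).congr fun p hp => ?_
  conv_lhs => rw [← hΨΦ p.1]
  exact ContinuumRobot.Robot.curve_Ψ (hdom p.1) hp.2
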